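/- All matroids are finite, and membership in a class and the relation "is a minor of" are understood up to isomorphism. Definitions. Write $r_M$ for the rank function of a matroid $M$. (1) Let $F$ be a flat of a matroid $M$. A principal extension of $M$ into $F$ is a matroid $M'$ on a ground set $E(M)\cup\{e\}$, where $e\notin E(M)$, such that $M'\setminus e=M$ and a subset of $E(M)$ spans $e$ in $M'$ if and only if it spans $F$. A class of matroids is natural when it is closed under isomorphism, minors, adding coloops, principal extensions, and direct sums. (2) The local connectivity of two sets $S,T\subseteq E(M)$ is $\sqcap_M(S,T)=r_M(S)+r_M(T)-r_M(S\cup T)$. A $3$-separation of $M$ is a partition $(S_1,S_2)$ of $E(M)$ with $|S_1|,|S_2|\ge 3$ and $\sqcap_M(S_1,S_2)<3$. (3) Let $e$ be a non-loop element of a matroid $M$. Then $M$ is a pinned extension into a $3$-separation of $M\setminus e$ if there are a $3$-separation $(S_1,S_2)$ of $M\setminus e$ and sets $Y_1\subseteq S_1$ and $Y_2\subseteq S_2$ such that $\sqcap_{M\setminus e}(Y_1,S_2)=\sqcap_{M\setminus e}(S_1,Y_2)=1$ and $e$ is spanned in $M$ by both $Y_1$ and $Y_2$. A class $\mathcal M$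 is closed under pinned extensions into $3$-separations if $M\in\mathcal M$ whenever $M$ is a pinned extension into a $3$-separation of $M\setminus e$ for some $e$ with $M\setminus e\in\mathcal M$. (4) An excluded minor for a class $\mathcal M$ is a matroid that is not in $\mathcal M$ but all of whose proper minors are in $\mathcal M$. Theorem. Let $\mathcal M_1$ and $\mathcal M_2$ be natural classes of matroids with $\mathcal M_1\subsetneq\mathcal M_2$, and suppose that $\mathcal M_1$ is closed under pinned extensions into $3$-separations. Then each matroid in $\mathcal M_1$ is a minor of an excluded minor for $\mathcal M_1$ that is also in $\mathcal M_2$. -/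

import Mathlib

universe u

namespace Matroid

/-- Two matroids, possibly on different ambient types, are isomorphic: some bijection between their
ground sets preserves independence in both directions. -/
def Isomorphic {α β : Type*} (M : Matroid α) (N : Matroid β) : Prop :=
  ∃ φ : M.E ≃ N.E, ∀ I : Set M.E,
    M.Indep ((fun x : M.E => (x : α)) '' I) ↔ N.Indep ((fun x : M.E => (φ x : β)) '' I)

/-- The rank of a set in a matroid, as a natural number (meaningful for finite matroids). -/
noncomputable def rankOf {α : Type*} (M : Matroid α) (X : Set α) : ℕ := (M.eRk X).toNat

/-- The local connectivity `⊓_M(S, T) = r(S) + r(T) - r(S ∪ T)`, as an integer. -/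
noncomputable def localConn {α : Type*} (M : Matroid α) (S T : Set α) : ℤ :=
  (M.rankOf S : ℤ) + M.rankOf T - M.rankOf (S ∪ T)

/-- `M'` is obtained from `M` by adding the new element `e` as a coloop. -/
def IsColoopExtension {α : Type*} (M : Matroid α) (e : α) (M' : Matroid α) : Prop :=
  e ∉ M.E ∧ M'.E = insert e M.E ∧ M' ＼ {e} = M ∧ M'.IsColoop e

/-- `M'` is the principal extension of `M` into the flat `F` by the new element `e`: deleting `e`
gives `M`, and a subset of `E(M)` spans `e` if and only if it spans `F`. -/
def IsPrincipalExtension {α : Type*} (M : Matroid α) (F : Set α) (e : α) (M' : Matroid α) : Prop :=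
  M.IsFlat F ∧ e ∉ M.E ∧ M'.E = insert e M.E ∧ M' ＼ {e} = M ∧
    ∀ X ⊆ M.E, (e ∈ M'.closure X ↔ F ⊆ M'.closure X)

/-- `(S₁, S₂)` is a `3`-separation of `M`: a partition of `E(M)` into two sets with at least three
elements each, with `r(S₁) + r(S₂) - r(M) < 3`. -/
def IsThreeSeparation {α : Type*} (M : Matroid α) (S₁ S₂ : Set α) : Prop :=
  S₁ ∪ S₂ = M.E ∧ Disjoint S₁ S₂ ∧ 3 ≤ S₁.encard ∧ 3 ≤ S₂.encard ∧ M.localConn S₁ S₂ < 3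

/-- `e` is a non-loop of `M`, and `M` is a pinned extension into a `3`-separation of `M ＼ e`. -/
def IsPinnedExtension {α : Type*} (M : Matroid α) (e : α) : Prop :=
  M.IsNonloop e ∧ ∃ S₁ S₂ Y₁ Y₂ : Set α,
    (M ＼ {e}).IsThreeSeparation S₁ S₂ ∧ Y₁ ⊆ S₁ ∧ Y₂ ⊆ S₂ ∧
    (M ＼ {e}).localConn Y₁ S₂ = 1 ∧ (M ＼ {e}).localConn S₁ Y₂ = 1 ∧
    e ∈ M.closure Y₁ ∧ e ∈ M.closure Y₂

end Matroid

/-- A class of matroids. As usual in this setting, matroids have finite ground sets. -/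
structure MatroidClass where
  /-- membership of a matroid in the class -/
  Mem : ∀ ⦃α : Type u⦄, Matroid α → Prop
  /-- all members are finite matroids -/
  finite_of_mem : ∀ ⦃α : Type u⦄ (M : Matroid α), Mem M → M.Finite

namespace MatroidClass

/-- `𝓜₁` is a proper subclass of `𝓜₂`. -/
def ProperSubclass (𝓜₁ 𝓜₂ : MatroidClass.{u}) : Prop :=
  (∀ (α : Type u) (M : Matroid α), 𝓜₁.Mem M → 𝓜₂.Mem M) ∧
    ∃ (α : Type u) (M : Matroid α), 𝓜₂.Mem M ∧ ¬ 𝓜₁.Mem M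

/-- A class is natural when it is closed under isomorphism, minors, adding coloops, principal
extensions, and direct sums. -/
structure IsNatural (𝓜 : MatroidClass.{u}) : Prop where
  isomorphic : ∀ (α β : Type u) (M : Matroid α) (N : Matroid β),
    𝓜.Mem M → M.Isomorphic N → 𝓜.Mem N
  minor : ∀ (α : Type u) (M N : Matroid α), 𝓜.Mem M → N.IsMinor M → 𝓜.Mem N
  coloop : ∀ (α : Type u) (M M' : Matroid α) (e : α),
    𝓜.Mem M → M.IsColoopExtension e M' → 𝓜.Mem M'
  principal : ∀ (α : Type u) (M M' : Matroid α) (F : Set α) (e : α),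
    𝓜.Mem M → M.IsPrincipalExtension F e M' → 𝓜.Mem M'
  directSum : ∀ (α : Type u) (M N : Matroid α) (h : Disjoint M.E N.E),
    𝓜.Mem M → 𝓜.Mem N → 𝓜.Mem (M.disjointSum N h)

/-- If a member of the class has a pinned extension into one of its `3`-separations, then this
extension is again in the class. -/
def ClosedUnderPinnedExtensions (𝓜 : MatroidClass.{u}) : Prop :=
  ∀ (α : Type u) (M : Matroid α) (e : α),
    𝓜.Mem (M.delete {e}) → M.IsPinnedExtension e → 𝓜.Mem M

/-- A (finite) matroid is an excluded minor for a class when it is not in the class but all of its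
proper minors are. -/
def IsExcludedMinor (𝓜 : MatroidClass.{u}) {α : Type u} (L : Matroid α) : Prop :=
  L.Finite ∧ ¬ 𝓜.Mem L ∧ ∀ N : Matroid α, N.IsStrictMinor L → 𝓜.Mem N

end MatroidClass

/-! Choose `R` in `𝓜₂` but not in `𝓜₁` with the fewest elements and, subject to that, the fewest
dependent sets. Call `e` freer than `f` if every set that avoids both and spans `e` also spans `f`.
This relation is transitive, so if all points of `R` were comparable there would be a freest one; it
would be a coloop or a principal extension into the whole matroid, and naturality would put `R` in
`𝓜₁`. So `R` has incomparable points `e`, `e'`. Add a point `p` freely on the line through them.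
Removing `e` or `e'` afterwards leaves a matroid of the size of `R` with fewer dependent sets, hence
a member of `𝓜₁` (`exists_isObstruction`).

The given `N` is a minor of `G ↾ (A ∪ B)`, where `A` and `B` are complementary independent
hyperplanes of this restriction and `G` adds a point `g` free on `A` and a point `g'` free on `B`
(`exists_isGadget`). The points `g` and `g'` are only just incomparable: deleting or contracting any
element of `A ∪ B` makes one freer than the other.

Now glue the extended `R` to `G`: in the direct sum, identify `e` with `g` and `e'` with `g'`, and
then delete all four points. Each identification is a truncation (place a point freely on the line
through the pair and contract it), so the result stays in `𝓜₂`. Were it in `𝓜₁`, then `e` and `e'`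
could be put back one after the other as pinned extensions, and `R` would lie in `𝓜₁`
(`glue_notMem`). But contracting any element, or deleting any element other than `p`, does lead into
`𝓜₁`. For elements on the side of `R` this is minimality. For an element of `A ∪ B` the points `g`
and `g'` become comparable, say `g` is freer; a set spanning `e = g` then also spans `e' = g'` and
so `p`, which allows the same matroid to be built without `e` (`IsNatural.glue_mem`).

Hence an excluded minor inside the glued matroid contracts nothing and deletes at most `p`. It keeps
`A ∪ B`, and with it `N`. -/

namespace Matroid

/-! ### Rank calculus in finite matroids -/

variable {α : Type*} {M : Matroid α} {X Y C D I R : Set α} {e f : α}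

lemma coe_rankOf (M : Matroid α) [M.RankFinite] (X : Set α) : (M.rankOf X : ℕ∞) = M.eRk X :=
  ENat.natCast_toNat (eRk_ne_top_iff.2 (M.isRkFinite_set X))

lemma rankOf_mono (M : Matroid α) [M.RankFinite] (h : X ⊆ Y) : M.rankOf X ≤ M.rankOf Y := by
  rw [← Nat.cast_le (α := ℕ∞), coe_rankOf, coe_rankOf]; exact M.eRk_mono h

@[simp] lemma rankOf_empty (M : Matroid α) : M.rankOf ∅ = 0 := by simp [rankOf]

@[simp] lemma rankOf_closure (M : Matroid α) (X : Set α) :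
    M.rankOf (M.closure X) = M.rankOf X := by simp [rankOf]

lemma rankOf_inter_ground (M : Matroid α) (X : Set α) : M.rankOf (X ∩ M.E) = M.rankOf X := by
  simp [rankOf]

lemma rankOf_insert_of_mem_closure (M : Matroid α) (h : e ∈ M.closure X) :
    M.rankOf (insert e X) = M.rankOf X := by
  rw [← rankOf_closure, closure_insert_eq_of_mem_closure h, rankOf_closure]

lemma rankOf_insert_of_notMem_closure (M : Matroid α) [M.RankFinite] (he : e ∈ M.E)
    (h : e ∉ M.closure X) : M.rankOf (insert e X) = M.rankOf X + 1 := by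
  rw [← Nat.cast_inj (R := ℕ∞)]
  push_cast
  rw [coe_rankOf, coe_rankOf, eRk_insert_eq_add_one ⟨he, h⟩]

lemma mem_closure_iff_rankOf (M : Matroid α) [M.RankFinite] (he : e ∈ M.E) :
    e ∈ M.closure X ↔ M.rankOf (insert e X) = M.rankOf X := by
  refine ⟨M.rankOf_insert_of_mem_closure, fun h ↦ by_contra fun h' ↦ ?_⟩
  have := M.rankOf_insert_of_notMem_closure he h'
  omega

lemma rankOf_insert_le (M : Matroid α) [M.RankFinite] (e : α) (X : Set α) :
    M.rankOf (insert e X) ≤ M.rankOf X + 1 := by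
  rw [← Nat.cast_le (α := ℕ∞)]
  push_cast
  rw [coe_rankOf, coe_rankOf]; exact M.eRk_insert_le_add_one e X

lemma closure_eq_closure_of_rankOf_le (M : Matroid α) [M.RankFinite] (h : X ⊆ Y)
    (h' : M.rankOf Y ≤ M.rankOf X) : M.closure X = M.closure Y := by
  refine (M.isRkFinite_set X).closure_eq_closure_of_subset_of_eRk_ge_eRk h ?_
  rw [← coe_rankOf, ← coe_rankOf]
  exact_mod_cast h'

lemma Indep.rankOf_eq_ncard (hI : M.Indep I) : M.rankOf I = I.ncard := by
  rw [rankOf, hI.eRk_eq_encard, Set.ncard]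

lemma rankOf_le_ncard (M : Matroid α) (hX : X.Finite) : M.rankOf X ≤ X.ncard := by
  rw [rankOf, Set.ncard]
  exact ENat.toNat_le_toNat (M.eRk_le_encard X) hX.encard_lt_top.ne

lemma indep_iff_rankOf [M.RankFinite] (hI : I.Finite) :
    M.Indep I ↔ M.rankOf I = I.ncard := by
  rw [indep_iff_eRk_eq_encard_of_finite hI, ← coe_rankOf, ← hI.cast_ncard_eq, Nat.cast_inj]

lemma rankOf_restrict (M : Matroid α) (h : X ⊆ R) : (M ↾ R).rankOf X = M.rankOf X := by
  rw [rankOf, restrict_eRk_eq _ h, rankOf]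

lemma rankOf_delete (M : Matroid α) (h : Disjoint X D) : (M ＼ D).rankOf X = M.rankOf X := by
  rw [← rankOf_inter_ground, delete_eq_restrict, restrict_ground_eq,
    rankOf_restrict _ Set.inter_subset_right, ← M.rankOf_inter_ground X]
  congr 1
  ext x
  have := fun h1 : x ∈ X ↦ h.notMem_of_mem_left h1
  simp only [Set.mem_inter_iff, Set.mem_sdiff]
  tauto

/-- Extend a basis `I` of `C` to a basis `J` of `X ∪ C`; then `J \ I` is a basis of `X` in the
contraction. -/
lemma eRk_contract_add (M : Matroid α) (X C : Set α) :
    (M ／ C).eRk X + M.eRk C = M.eRk (X ∪ C) := by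
  obtain ⟨I, hI⟩ := M.exists_isBasis' C
  obtain ⟨J, hJ, hIJ⟩ := hI.indep.subset_isBasis'_of_subset
    (hI.subset.trans (Set.subset_union_right (s := X)))
  have hJC : J ∩ C = I := by
    refine (hI.eq_of_subset_indep (hJ.indep.subset Set.inter_subset_left)
      (Set.subset_inter hIJ hI.subset) Set.inter_subset_right).symm
  have h1 := hJ.contract_isBasis'_sdiff_of_subset hIJ
  have h2 : (M ／ C).IsBasis' (J \ I) X := by
    rw [hI.contract_eq_contract_delete, delete_isBasis'_iff]
    have hsub : J \ I ⊆ X \ (C \ I) := by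
      rintro x ⟨hx, hxI⟩
      have hxC : x ∉ C := fun h ↦ hxI (hJC ▸ ⟨hx, h⟩)
      exact ⟨(hJ.subset hx).resolve_right hxC, fun h ↦ hxC h.1⟩
    rw [isBasis'_iff_isBasis_inter_ground] at h1 ⊢
    refine h1.isBasis_subset ?_ ?_
    · exact Set.subset_inter hsub h1.indep.subset_ground
    rintro x ⟨⟨hx, hx'⟩, hxE⟩
    exact ⟨Or.inl hx, hxE⟩
  rw [h2.eRk_eq_encard, hI.eRk_eq_encard, hJ.eRk_eq_encard, Set.encard_sdiff_add_encard_of_subset hIJ]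

lemma rankOf_contract_add (M : Matroid α) [M.RankFinite] (X C : Set α) :
    (M ／ C).rankOf X + M.rankOf C = M.rankOf (X ∪ C) := by
  rw [← Nat.cast_inj (R := ℕ∞)]
  push_cast
  rw [coe_rankOf, coe_rankOf, coe_rankOf, eRk_contract_add]

lemma ext_rankOf {M N : Matroid α} [M.Finite] [N.Finite] (hE : M.E = N.E)
    (h : ∀ X ⊆ M.E, M.rankOf X = N.rankOf X) : M = N := by
  refine ext_indep hE fun I hI ↦ ?_
  rw [indep_iff_rankOf (M.ground_finite.subset hI), indep_iff_rankOf (M.ground_finite.subset hI),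
    h I hI]

lemma rankOf_pair_nonloop [M.RankFinite] : M.IsNonloop e ↔ M.rankOf {e} = 1 := by
  rw [← eRk_singleton_eq_one_iff, ← coe_rankOf]
  norm_cast

end Matroid

/-! ### Placing a point freely in a flat -/

open Classical in
/-- The number `1` if `p` holds and `0` otherwise. -/
noncomputable def boolNat (p : Prop) : ℕ := if p then 1 else 0

lemma boolNat_true {p : Prop} (h : p) : boolNat p = 1 := if_pos h

lemma boolNat_false {p : Prop} (h : ¬ p) : boolNat p = 0 := if_neg h

lemma boolNat_le (p : Prop) : boolNat p ≤ 1 := by unfold boolNat; split_ifs <;> omega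

lemma boolNat_congr {p q : Prop} (h : p ↔ q) : boolNat p = boolNat q := by rw [propext h]

namespace Matroid

variable {α : Type*} {M P : Matroid α} {F X Y C D I R : Set α} {e f : α}

/-- `P` is obtained from `M` by placing the new element `e` freely in the flat spanned by `F`. -/
structure IsFreeExt (M : Matroid α) (F : Set α) (e : α) (P : Matroid α) : Prop where
  subset_ground : F ⊆ M.E
  notMem : e ∉ M.E
  ground_eq : P.E = insert e M.E
  rankOf_eq : ∀ X ⊆ M.E, P.rankOf X = M.rankOf X
  rankOf_insert : ∀ X ⊆ M.E,
    P.rankOf (insert e X) + boolNat (F ⊆ M.closure X) = M.rankOf X + 1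

/-- This is augmentation for `freeExt` when the new point is in the smaller set. If it fails, fix `f
∈ F` outside the closure of `I`. By exchange, each `x ∈ J` outside that closure generates with `I`
the same flat as `f` does. So `J` lies in a flat of rank `|I| + 1`, spans it, and thus spans `F`,
which `h` excludes by size. -/
lemma exists_insert_not_subset_closure {I J : Set α} [M.Finite] (hI : M.Indep I) (hJ : M.Indep J)
    (hFI : ¬ F ⊆ M.closure I) (hIJ : I.ncard < J.ncard)
    (h : F ⊆ M.closure J → I.ncard + 1 < J.ncard) :
    ∃ x ∈ J, x ∉ I ∧ M.Indep (insert x I) ∧ ¬ F ⊆ M.closure (insert x I) := by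
  by_contra! hcon
  obtain ⟨f, hfF, hf⟩ := Set.not_subset.1 hFI
  have hall : ∀ x ∈ J, x ∉ M.closure I → F ⊆ M.closure (insert x I) := by
    intro x hx hxI
    have hxI' : x ∉ I := fun h ↦ hxI (M.mem_closure_of_mem h hI.subset_ground)
    exact hcon x hx hxI' ((hI.insert_indep_iff_of_notMem hxI').2 ⟨hJ.subset_ground hx, hxI⟩)
  have hJf : J ⊆ M.closure (insert f I) := by
    intro x hx
    by_cases hxI : x ∈ M.closure I
    · exact M.closure_subset_closure (Set.subset_insert _ _) hxI
    exact (closure_exchange ⟨hall x hx hxI hfF, hf⟩).1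
  have hr1 : M.rankOf J = J.ncard := hJ.rankOf_eq_ncard
  have hr2 := M.rankOf_insert_le f I
  have hr3 : M.rankOf I = I.ncard := hI.rankOf_eq_ncard
  have hr4 := M.rankOf_mono hJf
  rw [rankOf_closure] at hr4
  have hnJ : ¬ F ⊆ M.closure J := fun h' ↦ by have := h h'; omega
  obtain ⟨x, hxJ, hx⟩ : ∃ x ∈ J, x ∉ M.closure I := by
    by_contra! hc
    have := M.rankOf_mono hc
    rw [rankOf_closure] at this
    omega
  have h1 : M.closure (insert f I) = M.closure (insert x I) :=
    closure_insert_congr ⟨hall x hxJ hx hfF, hf⟩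
  have h2 := M.closure_eq_closure_of_rankOf_le hJf (by rw [rankOf_closure]; omega)
  rw [closure_closure] at h2
  exact hnJ (h2 ▸ h1 ▸ hall x hxJ hx)

/-- The matroid obtained from `M` by placing `e` freely in the flat spanned by `F`. -/
noncomputable def freeExt (M : Matroid α) [hM : M.Finite] (F : Set α) (e : α) :
    Matroid α :=
  (IndepMatroid.ofFinite (E := insert e M.E) (hM.ground_finite.insert e)
    (fun I ↦ I ⊆ insert e M.E ∧ M.Indep (I \ {e}) ∧ (e ∈ I → ¬ F ⊆ M.closure (I \ {e})))
    (by simp)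
    (by
      refine fun I J hJ hIJ ↦ ⟨hIJ.trans hJ.1, hJ.2.1.subset (Set.sdiff_subset_sdiff_left hIJ),
        fun heI h ↦ hJ.2.2 (hIJ heI) (h.trans (M.closure_subset_closure
          (Set.sdiff_subset_sdiff_left hIJ)))⟩)
    (by
      rintro I J ⟨hIE, hI, heI⟩ ⟨hJE, hJ, heJ⟩ hIJ
      have hIfin : I.Finite := (hM.ground_finite.insert e).subset hIE
      have hJfin : J.Finite := (hM.ground_finite.insert e).subset hJE
      have key : ∀ x ∈ J, x ≠ e → insert x I ⊆ insert e M.E ∧ insert x I \ {e} =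
          insert x (I \ {e}) := fun x hx hxe ↦ ⟨Set.insert_subset (hJE hx) hIE, by
            rw [Set.insert_sdiff_of_notMem _ (by simpa using hxe)]⟩
      have cardJ : e ∈ J → (J \ {e}).ncard + 1 = J.ncard :=
        fun h ↦ Set.ncard_sdiff_singleton_add_one h hJfin
      have cardJ' : e ∉ J → J \ {e} = J := Set.sdiff_singleton_eq_self
      by_cases he : e ∈ I
      · have cardI := Set.ncard_sdiff_singleton_add_one he hIfin
        obtain ⟨x, hxJ, hxI, hx, hx'⟩ := exists_insert_not_subset_closure hI hJ (heI he)
          (by by_cases h : e ∈ J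
              · have := cardJ h; omega
              · rw [cardJ' h]; omega)
          (by
            intro h
            by_cases h' : e ∈ J
            · exact absurd h (heJ h')
            · rw [cardJ' h']; omega)
        refine ⟨x, hxJ.1, fun h ↦ hxI ⟨h, hxJ.2⟩, (key x hxJ.1 hxJ.2).1, ?_⟩
        rw [(key x hxJ.1 hxJ.2).2]
        exact ⟨hx, fun _ ↦ hx'⟩
      rw [Set.sdiff_singleton_eq_self he] at hI
      by_cases hlt : ∃ x ∈ J \ {e}, x ∉ M.closure I
      · obtain ⟨x, hxJ, hxI⟩ := hlt
        have hxI' : x ∉ I := fun h ↦ hxI (M.mem_closure_of_mem h hI.subset_ground)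
        refine ⟨x, hxJ.1, hxI', (key x hxJ.1 hxJ.2).1, ?_⟩
        rw [(key x hxJ.1 hxJ.2).2, Set.sdiff_singleton_eq_self he]
        exact ⟨(hI.insert_indep_iff_of_notMem hxI').2 ⟨hJ.subset_ground hxJ, hxI⟩,
          fun h ↦ absurd h (by simp [he, Ne.symm hxJ.2])⟩
      -- Now `J \ {e}` lies in the closure of `I`. Comparing sizes, `e ∈ J` and both sets span the
      -- same flat, so `e` itself can be added.
      push Not at hlt
      have hr := M.rankOf_mono (show J \ {e} ⊆ M.closure I from hlt)
      rw [rankOf_closure, hI.rankOf_eq_ncard, hJ.rankOf_eq_ncard] at hr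
      have heJ' : e ∈ J := by
        by_contra h
        rw [cardJ' h] at hr
        omega
      have hc := M.closure_eq_closure_of_rankOf_le (show J \ {e} ⊆ M.closure I from hlt)
        (by
          have := cardJ heJ'
          rw [rankOf_closure, hI.rankOf_eq_ncard, hJ.rankOf_eq_ncard]; omega)
      rw [closure_closure] at hc
      refine ⟨e, heJ', he, Set.insert_subset (Set.mem_insert _ _) hIE, ?_⟩
      rw [Set.insert_sdiff_self_of_notMem he]
      exact ⟨hI, fun _ ↦ hc ▸ heJ heJ'⟩)
    (fun _ h ↦ h.1)).matroid

lemma freeExt_indep_iff [hM : M.Finite] :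
    (M.freeExt F e).Indep I ↔
      I ⊆ insert e M.E ∧ M.Indep (I \ {e}) ∧ (e ∈ I → ¬ F ⊆ M.closure (I \ {e})) := Iff.rfl

lemma isFreeExt_freeExt (M : Matroid α) [hM : M.Finite] (hF : F ⊆ M.E) (he : e ∉ M.E) :
    M.IsFreeExt F e (M.freeExt F e) := by
  set P := M.freeExt F e with hP
  have hPE : P.E = insert e M.E := rfl
  have hPfin : P.Finite := ⟨by rw [hPE]; exact hM.ground_finite.insert e⟩
  have hdel : P ＼ {e} = M := by
    refine ext_indep (by simp [hPE, he]) fun I hI ↦ ?_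
    have heI : e ∉ I := fun h ↦ (hI h).2 rfl
    rw [delete_indep_iff, hP, freeExt_indep_iff, Set.sdiff_singleton_eq_self heI]
    simp only [heI, false_implies, and_true, Set.disjoint_singleton_right, not_false_eq_true]
    exact ⟨fun h ↦ h.2, fun h ↦ ⟨h.subset_ground.trans (Set.subset_insert _ _), h⟩⟩
  have hrk : ∀ X ⊆ M.E, P.rankOf X = M.rankOf X := fun X hX ↦ by
    rw [← hdel, rankOf_delete]
    exact Set.disjoint_singleton_right.2 fun h ↦ he (hX h)
  refine ⟨hF, he, hPE, hrk, fun X hX ↦ ?_⟩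
  obtain ⟨I, hI⟩ := M.exists_isBasis X
  have heI : e ∉ I := fun h ↦ he (hX (hI.subset h))
  have hIP : P.IsBasis I X := by
    rw [← hdel, delete_isBasis_iff] at hI
    exact hI.1
  have hmem : e ∈ P.closure X ↔ F ⊆ M.closure X := by
    rw [← hIP.closure_eq_closure, ← hI.closure_eq_closure,
      hIP.indep.mem_closure_iff_of_notMem heI, dep_iff, hP, freeExt_indep_iff,
      Set.insert_sdiff_self_of_notMem heI]
    have h1 : insert e I ⊆ insert e M.E := Set.insert_subset_insert hI.indep.subset_ground
    have h2 : insert e I ⊆ P.E := h1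
    simp [h1, hI.indep, ← hP, h2]
  by_cases h : F ⊆ M.closure X
  · rw [boolNat_true h, rankOf_insert_of_mem_closure _ (hmem.2 h), hrk X hX]
  · rw [boolNat_false h, rankOf_insert_of_notMem_closure _ (hPE ▸ Set.mem_insert _ _)
      (fun h' ↦ h (hmem.1 h')), hrk X hX]

end Matroid

/-! ### Truncations and direct sums, and their minors -/

namespace Matroid

variable {α : Type*} {M N P S T : Matroid α} {F X Y C D I R : Set α} {e f : α}

lemma rankOf_contract (M : Matroid α) [M.RankFinite] (X C : Set α) :
    (M ／ C).rankOf X = M.rankOf (X ∪ C) - M.rankOf C := by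
  rw [← rankOf_contract_add]; omega

lemma mem_closure_contract_iff (M : Matroid α) (hf : f ∉ C) :
    f ∈ (M ／ C).closure X ↔ f ∈ M.closure (X ∪ C) := by
  simp [contract_closure_eq, hf]

lemma subset_closure_contract_iff (M : Matroid α) (hF : Disjoint F C) :
    F ⊆ (M ／ C).closure X ↔ F ⊆ M.closure (X ∪ C) :=
  forall₂_congr fun _ hf ↦ M.mem_closure_contract_iff (hF.notMem_of_mem_left hf)

lemma mem_closure_delete_iff (M : Matroid α) (hX : Disjoint X D) (hf : f ∉ D) :
    f ∈ (M ＼ D).closure X ↔ f ∈ M.closure X := by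
  simp [delete_closure_eq_of_disjoint _ hX, hf]

lemma subset_closure_delete_iff (M : Matroid α) (hX : Disjoint X D) (hF : Disjoint F D) :
    F ⊆ (M ＼ D).closure X ↔ F ⊆ M.closure X :=
  forall₂_congr fun _ hf ↦ M.mem_closure_delete_iff hX (hF.notMem_of_mem_left hf)

namespace IsFreeExt

lemma finite [M.Finite] (h : M.IsFreeExt F e P) : P.Finite :=
  ⟨by rw [h.ground_eq]; exact M.ground_finite.insert e⟩

lemma mem_ground (h : M.IsFreeExt F e P) : e ∈ P.E := h.ground_eq ▸ Set.mem_insert _ _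

lemma subset_ground' (h : M.IsFreeExt F e P) : M.E ⊆ P.E := h.ground_eq ▸ Set.subset_insert _ _

lemma mem_closure_iff [M.Finite] (h : M.IsFreeExt F e P) (hX : X ⊆ M.E) :
    e ∈ P.closure X ↔ F ⊆ M.closure X := by
  have := h.finite
  rw [mem_closure_iff_rankOf _ h.mem_ground, h.rankOf_eq X hX]
  have := h.rankOf_insert X hX
  by_cases hF : F ⊆ M.closure X
  · rw [boolNat_true hF] at this
    simp only [hF, iff_true]; omega
  · rw [boolNat_false hF] at this
    simp only [hF, iff_false]; omega

lemma mem_closure_iff_of_mem [M.Finite] (h : M.IsFreeExt F e P) (hX : X ⊆ M.E) (hf : f ∈ M.E) :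
    f ∈ P.closure X ↔ f ∈ M.closure X := by
  have := h.finite
  rw [mem_closure_iff_rankOf _ (h.subset_ground' hf), mem_closure_iff_rankOf _ hf,
    h.rankOf_eq X hX, h.rankOf_eq _ (Set.insert_subset hf hX)]

lemma delete_eq [M.Finite] (h : M.IsFreeExt F e P) : P ＼ {e} = M := by
  have := h.finite
  have hE : (P ＼ {e}).E = M.E := by simp [h.ground_eq, h.notMem]
  refine ext_rankOf hE fun X hX ↦ ?_
  rw [rankOf_delete, h.rankOf_eq X (hE ▸ hX)]
  exact Set.disjoint_singleton_right.2 fun heX ↦ (hX heX).2 rfl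

lemma isPrincipalExtension [M.Finite] (h : M.IsFreeExt F e P) :
    M.IsPrincipalExtension (M.closure F) e P := by
  refine ⟨isFlat_closure _, h.notMem, h.ground_eq, h.delete_eq, fun X hX ↦ ?_⟩
  rw [h.mem_closure_iff hX, ← closure_subset_closure_iff_subset_closure h.subset_ground]
  exact forall₂_congr fun f hf ↦ (h.mem_closure_iff_of_mem hX (mem_ground_of_mem_closure hf)).symm

lemma delete [M.Finite] (h : M.IsFreeExt F e P) (heD : e ∉ D) (hF : Disjoint F D) :
    (M ＼ D).IsFreeExt F e (P ＼ D) := by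
  have hd : ∀ X ⊆ M.E \ D, Disjoint X D := fun X hX ↦
    Set.disjoint_sdiff_left.mono_left hX
  refine ⟨Set.subset_sdiff.2 ⟨h.subset_ground, hF⟩, fun h' ↦ h.notMem h'.1, ?_, fun X hX ↦ ?_,
    fun X hX ↦ ?_⟩
  · rw [delete_ground, delete_ground, h.ground_eq, Set.insert_sdiff_of_notMem _ heD]
  · rw [rankOf_delete _ (hd X hX), rankOf_delete _ (hd X hX),
      h.rankOf_eq X (hX.trans Set.sdiff_subset)]
  · rw [rankOf_delete _ (hd X hX), rankOf_delete _ (Set.disjoint_insert_left.2 ⟨heD, hd X hX⟩),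
      ← h.rankOf_insert X (hX.trans Set.sdiff_subset),
      boolNat_congr (M.subset_closure_delete_iff (hd X hX) hF)]

lemma contract [M.Finite] (h : M.IsFreeExt F e P) (hC : C ⊆ M.E) (hF : Disjoint F C) :
    (M ／ C).IsFreeExt F e (P ／ C) := by
  have := h.finite
  have heC : e ∉ C := fun h' ↦ h.notMem (hC h')
  refine ⟨Set.subset_sdiff.2 ⟨h.subset_ground, hF⟩, fun h' ↦ h.notMem h'.1, ?_, fun X hX ↦ ?_,
    fun X hX ↦ ?_⟩
  · rw [contract_ground, contract_ground, h.ground_eq, Set.insert_sdiff_of_notMem _ heC]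
  · rw [rankOf_contract, rankOf_contract, h.rankOf_eq C hC,
      h.rankOf_eq _ (Set.union_subset (hX.trans Set.sdiff_subset) hC)]
  · have hXC := (Set.union_subset (hX.trans Set.sdiff_subset) hC)
    rw [boolNat_congr (M.subset_closure_contract_iff hF)]
    have h1 := P.rankOf_contract_add (insert e X) C
    have h2 := M.rankOf_contract_add X C
    rw [h.rankOf_eq C hC, Set.insert_union] at h1
    have := h.rankOf_insert _ hXC
    omega

end IsFreeExt

/-- `T` is obtained from `M` by placing a new element freely in the flat spanned by `F` and then
contracting this element. -/
structure IsTrunc (M : Matroid α) (F : Set α) (T : Matroid α) : Prop where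
  subset_ground : F ⊆ M.E
  ground_eq : T.E = M.E
  -- The term at `∅` is nonzero only if `F` consists of loops: the new point is then a loop, and
  -- contracting it lowers no rank.
  rankOf_add : ∀ X ⊆ M.E,
    T.rankOf X + boolNat (F ⊆ M.closure X) = M.rankOf X + boolNat (F ⊆ M.closure ∅)

namespace IsTrunc

lemma finite [hM : M.Finite] (h : M.IsTrunc F T) : T.Finite := ⟨h.ground_eq ▸ hM.ground_finite⟩

lemma closure_subset [M.Finite] (h : M.IsTrunc F T) (hX : X ⊆ M.E) :
    M.closure X ⊆ T.closure X := by
  have := h.finite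
  intro f hf
  have hfE := mem_ground_of_mem_closure hf
  rw [mem_closure_iff_rankOf _ (h.ground_eq ▸ hfE)]
  have h1 := h.rankOf_add X hX
  have h2 := h.rankOf_add _ (Set.insert_subset hfE hX)
  rw [closure_insert_eq_of_mem_closure hf, rankOf_insert_of_mem_closure _ hf] at h2
  omega

lemma eq [M.Finite] {T' : Matroid α} (h : M.IsTrunc F T) (h' : M.IsTrunc F T') : T = T' := by
  have := h.finite
  have := h'.finite
  refine ext_rankOf (h.ground_eq.trans h'.ground_eq.symm) fun X hX ↦ ?_
  have h1 := h.rankOf_add X (h.ground_eq ▸ hX)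
  have h2 := h'.rankOf_add X (h.ground_eq ▸ hX)
  omega

lemma delete [M.Finite] (h : M.IsTrunc F T) (hF : Disjoint F D) :
    (M ＼ D).IsTrunc F (T ＼ D) := by
  refine ⟨Set.subset_sdiff.2 ⟨h.subset_ground, hF⟩, by simp [h.ground_eq], fun X hX ↦ ?_⟩
  have hd : Disjoint X D := Set.disjoint_sdiff_left.mono_left hX
  rw [rankOf_delete _ hd, rankOf_delete _ hd, boolNat_congr (M.subset_closure_delete_iff hd hF),
    boolNat_congr (M.subset_closure_delete_iff (Set.empty_disjoint _) hF)]
  exact h.rankOf_add X (hX.trans Set.sdiff_subset)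

lemma contract [M.Finite] (h : M.IsTrunc F T) (hC : C ⊆ M.E) (hF : Disjoint F C) :
    (M ／ C).IsTrunc F (T ／ C) := by
  have := h.finite
  refine ⟨Set.subset_sdiff.2 ⟨h.subset_ground, hF⟩, by simp [h.ground_eq], fun X hX ↦ ?_⟩
  rw [boolNat_congr (M.subset_closure_contract_iff hF),
    boolNat_congr (M.subset_closure_contract_iff hF), Set.empty_union]
  have h1 := T.rankOf_contract_add X C
  have h2 := M.rankOf_contract_add X C
  have h3 := h.rankOf_add _ (Set.union_subset (hX.trans Set.sdiff_subset) hC)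
  have h4 := h.rankOf_add C hC
  omega

end IsTrunc

lemma IsFreeExt.isTrunc [M.Finite] (h : M.IsFreeExt F e P) : M.IsTrunc F (P ／ {e}) := by
  have := h.finite
  refine ⟨h.subset_ground, by simp [h.ground_eq, h.notMem], fun X hX ↦ ?_⟩
  have h1 := P.rankOf_contract_add X {e}
  rw [Set.union_singleton] at h1
  have h2 := h.rankOf_insert X hX
  have h3 := h.rankOf_insert ∅ (Set.empty_subset _)
  rw [insert_empty_eq, rankOf_empty] at h3
  omega

lemma exists_isTrunc [Infinite α] (M : Matroid α) [M.Finite] (hF : F ⊆ M.E) :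
    ∃ T, M.IsTrunc F T := by
  obtain ⟨e, he⟩ := M.ground_finite.exists_notMem
  exact ⟨_, (M.isFreeExt_freeExt hF he).isTrunc⟩

/-- `S` is the direct sum of `M` and `N`. -/
structure IsSum (M N S : Matroid α) : Prop where
  disjoint : Disjoint M.E N.E
  ground_eq : S.E = M.E ∪ N.E
  rankOf_union : ∀ X ⊆ M.E, ∀ Y ⊆ N.E, S.rankOf (X ∪ Y) = M.rankOf X + N.rankOf Y

lemma isSum_disjointSum [M.Finite] [N.Finite] (h : Disjoint M.E N.E) :
    M.IsSum N (M.disjointSum N h) := by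
  refine ⟨h, by simp, fun X hX Y hY ↦ ?_⟩
  obtain ⟨I, hI⟩ := M.exists_isBasis X
  obtain ⟨J, hJ⟩ := N.exists_isBasis Y
  have hb : (M.disjointSum N h).IsBasis (I ∪ J) (X ∪ Y) := by
    have hX' : Disjoint X N.E := h.mono_left hX
    have hI' : Disjoint I N.E := hX'.mono_left hI.subset
    have hY' : Disjoint Y M.E := h.symm.mono_left hY
    have hJ' : Disjoint J M.E := hY'.mono_left hJ.subset
    rw [disjointSum_isBasis_iff]
    simp only [Set.union_inter_distrib_right, Set.inter_eq_self_of_subset_left hX,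
      Set.inter_eq_self_of_subset_left hY, Set.inter_eq_self_of_subset_left hI.indep.subset_ground,
      Set.inter_eq_self_of_subset_left hJ.indep.subset_ground, hX'.inter_eq, hI'.inter_eq,
      hY'.inter_eq, hJ'.inter_eq, Set.union_empty, Set.empty_union]
    exact ⟨hI, hJ, Set.union_subset_union hI.subset hJ.subset, Set.union_subset_union hX hY⟩
  have hfI := M.ground_finite.subset hI.indep.subset_ground
  have hfJ := N.ground_finite.subset hJ.indep.subset_ground
  have hd : Disjoint I J := h.mono hI.indep.subset_ground hJ.indep.subset_ground
  rw [rankOf, rankOf, rankOf, hb.eRk_eq_encard, hI.eRk_eq_encard, hJ.eRk_eq_encard,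
    Set.encard_union_eq hd, ENat.toNat_add hfI.encard_lt_top.ne hfJ.encard_lt_top.ne]

namespace IsSum

lemma finite [hM : M.Finite] [hN : N.Finite] (h : M.IsSum N S) : S.Finite :=
  ⟨h.ground_eq ▸ hM.ground_finite.union hN.ground_finite⟩

lemma rankOf_eq (h : M.IsSum N S) (hX : X ⊆ S.E) :
    S.rankOf X = M.rankOf (X ∩ M.E) + N.rankOf (X ∩ N.E) := by
  rw [← h.rankOf_union _ Set.inter_subset_right _ Set.inter_subset_right,
    ← Set.inter_union_distrib_left, ← h.ground_eq, Set.inter_eq_self_of_subset_left hX]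

lemma eq_disjointSum [M.Finite] [N.Finite] (h : M.IsSum N S) :
    S = M.disjointSum N h.disjoint := by
  have h' := isSum_disjointSum h.disjoint
  have := h.finite
  have := h'.finite
  refine ext_rankOf (h.ground_eq.trans h'.ground_eq.symm) fun X hX ↦ ?_
  rw [h.rankOf_eq hX, h'.rankOf_eq (by rwa [h'.ground_eq, ← h.ground_eq])]

lemma symm (h : M.IsSum N S) : N.IsSum M S :=
  ⟨h.disjoint.symm, h.ground_eq.trans (Set.union_comm _ _), fun X hX Y hY ↦ by
    rw [Set.union_comm, h.rankOf_union Y hY X hX, add_comm]⟩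

lemma delete_left (h : M.IsSum N S) (hD : Disjoint D N.E) : (M ＼ D).IsSum N (S ＼ D) := by
  refine ⟨h.disjoint.mono_left Set.sdiff_subset, ?_, fun X hX Y hY ↦ ?_⟩
  · rw [delete_ground, h.ground_eq, Set.union_sdiff_distrib, hD.symm.sdiff_eq_left, delete_ground]
  have hXD : Disjoint X D := Set.disjoint_sdiff_left.mono_left hX
  rw [rankOf_delete, rankOf_delete _ hXD, h.rankOf_union X (hX.trans Set.sdiff_subset) Y hY]
  exact Set.disjoint_union_left.2 ⟨hXD, hD.symm.mono_left hY⟩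

lemma contract_left [M.Finite] [N.Finite] (h : M.IsSum N S) (hC : C ⊆ M.E) :
    (M ／ C).IsSum N (S ／ C) := by
  have := h.finite
  refine ⟨h.disjoint.mono_left Set.sdiff_subset, ?_, fun X hX Y hY ↦ ?_⟩
  · rw [contract_ground, h.ground_eq, Set.union_sdiff_distrib,
      (h.disjoint.symm.mono_right hC).sdiff_eq_left, contract_ground]
  have h1 := S.rankOf_contract_add (X ∪ Y) C
  have h2 := M.rankOf_contract_add X C
  have h3 := h.rankOf_union _ (Set.union_subset (hX.trans Set.sdiff_subset) hC) Y hY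
  have h4 := h.rankOf_union C hC ∅ (Set.empty_subset _)
  rw [Set.union_right_comm] at h1
  rw [Set.union_empty, rankOf_empty] at h4
  omega

lemma mem_closure_iff [M.Finite] [N.Finite] (h : M.IsSum N S) (hX : X ⊆ M.E) (hY : Y ⊆ N.E)
    (hf : f ∈ M.E) : f ∈ S.closure (X ∪ Y) ↔ f ∈ M.closure X := by
  have := h.finite
  rw [mem_closure_iff_rankOf _ hf, mem_closure_iff_rankOf _ (h.ground_eq ▸ Or.inl hf),
    ← Set.insert_union, h.rankOf_union _ (Set.insert_subset hf hX) Y hY, h.rankOf_union X hX Y hY]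
  omega

lemma mem_closure_iff' [M.Finite] [N.Finite] (h : M.IsSum N S) (hX : X ⊆ M.E) (hY : Y ⊆ N.E)
    (hf : f ∈ N.E) : f ∈ S.closure (X ∪ Y) ↔ f ∈ N.closure Y := by
  rw [Set.union_comm, h.symm.mem_closure_iff hY hX hf]

end IsSum

lemma isomorphic_map {β : Type*} (M : Matroid α) (φ : α → β) (hφ : Set.InjOn φ M.E) :
    M.Isomorphic (M.map φ hφ) := by
  refine ⟨Equiv.Set.imageOfInjOn φ M.E hφ, fun I ↦ ?_⟩
  change M.Indep (Subtype.val '' I) ↔ (M.map φ hφ).Indep ((fun x : M.E ↦ φ x) '' I)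
  rw [← Set.image_image φ Subtype.val, map_image_indep_iff (by simp)]

lemma Isomorphic.symm {β : Type*} {M : Matroid α} {N : Matroid β} (h : M.Isomorphic N) :
    N.Isomorphic M := by
  obtain ⟨φ, hφ⟩ := h
  refine ⟨φ.symm, fun I ↦ ?_⟩
  have h1 := hφ (φ.symm '' I)
  rw [Set.image_image, Set.image_image] at h1
  simp only [Equiv.apply_symm_apply] at h1
  exact h1.symm

end Matroid

/-! ### Closure of natural classes under these operations -/

namespace MatroidClass

open Matroid

variable {𝓜 : MatroidClass.{u}} {β : Type u} {M N P S T : Matroid β} {F D C : Set β} {e : β}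

lemma IsNatural.freeExt (h : 𝓜.IsNatural) (hM : 𝓜.Mem M) (hP : M.IsFreeExt F e P) : 𝓜.Mem P := by
  have := 𝓜.finite_of_mem M hM
  exact h.principal _ _ _ _ _ hM hP.isPrincipalExtension

lemma IsNatural.delete (h : 𝓜.IsNatural) (hM : 𝓜.Mem M) (D : Set β) : 𝓜.Mem (M ＼ D) :=
  h.minor _ _ _ hM ⟨∅, D, by simp⟩

lemma IsNatural.contract (h : 𝓜.IsNatural) (hM : 𝓜.Mem M) (C : Set β) : 𝓜.Mem (M ／ C) :=
  h.minor _ _ _ hM ⟨C, ∅, by simp⟩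

lemma IsNatural.trunc [Infinite β] (h : 𝓜.IsNatural) (hM : 𝓜.Mem M) (hT : M.IsTrunc F T) :
    𝓜.Mem T := by
  have := 𝓜.finite_of_mem M hM
  obtain ⟨e, he⟩ := M.ground_finite.exists_notMem
  have hP := M.isFreeExt_freeExt hT.subset_ground he
  rw [hT.eq hP.isTrunc]
  exact h.contract (h.freeExt hM hP) _

lemma IsNatural.sum (h : 𝓜.IsNatural) (hM : 𝓜.Mem M) (hN : 𝓜.Mem N) (hS : M.IsSum N S) :
    𝓜.Mem S := by
  have := 𝓜.finite_of_mem M hM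
  have := 𝓜.finite_of_mem N hN
  rw [hS.eq_disjointSum]
  exact h.directSum _ _ _ _ hM hN

lemma IsNatural.map {γ : Type u} (h : 𝓜.IsNatural) (hM : 𝓜.Mem M) (φ : β → γ)
    (hφ : Set.InjOn φ M.E) : 𝓜.Mem (M.map φ hφ) :=
  h.isomorphic _ _ _ _ hM (M.isomorphic_map φ hφ)

end MatroidClass

/-! ### Commuting truncations, and gluing along two pairs of points -/

namespace Matroid

variable {α : Type*} {M N P R G S T U V : Matroid α} {F F' X Y Y' A B Q K : Set α}
  {e e' f g g' p : α}

/-- Adding `f` outside the closure of `X` raises the rank by one, and the truncation takes this back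
exactly when `f` is what makes `F` spanned. -/
lemma IsTrunc.mem_closure_iff [M.Finite] (h : M.IsTrunc F T) (hX : X ⊆ M.E) (hf : f ∈ M.E) :
    f ∈ T.closure X ↔
      f ∈ M.closure X ∨ (¬ F ⊆ M.closure X ∧ F ⊆ M.closure (insert f X)) := by
  have := h.finite
  refine ⟨fun hfT ↦ or_iff_not_imp_left.2 fun hfM ↦ ?_, ?_⟩
  · rw [mem_closure_iff_rankOf _ (h.ground_eq ▸ hf)] at hfT
    have h1 := h.rankOf_add X hX
    have h2 := h.rankOf_add _ (Set.insert_subset hf hX)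
    rw [M.rankOf_insert_of_notMem_closure hf hfM] at h2
    have h3 := boolNat_le (F ⊆ M.closure (insert f X))
    constructor
    · intro hF
      rw [boolNat_true hF] at h1
      omega
    · by_contra hF
      rw [boolNat_false hF] at h2
      omega
  rintro (hfM | ⟨hF, hF'⟩)
  · exact h.closure_subset hX hfM
  have h1 := h.rankOf_add X hX
  have h2 := h.rankOf_add _ (Set.insert_subset hf hX)
  rw [boolNat_true hF'] at h2
  rw [boolNat_false hF] at h1
  rw [mem_closure_iff_rankOf _ (h.ground_eq ▸ hf)]
  have h3 := M.rankOf_insert_le f X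
  have h4 := T.rankOf_mono (Set.subset_insert f X)
  omega

/-- A point of `F'` that only the truncation puts in the closure of `X` generates `F` together with
`X`; exchanging it with points of `F` gives the reverse relation. -/
lemma IsTrunc.subset_closure_comm [M.Finite] (hT : M.IsTrunc F T) (hV : M.IsTrunc F' V)
    (hX : X ⊆ M.E) (hF' : ¬ F' ⊆ M.closure X)
    (h : F' ⊆ T.closure X) : F ⊆ V.closure X := by
  intro f hf
  by_cases hfX : f ∈ M.closure X
  · exact hV.closure_subset hX hfX
  refine (hV.mem_closure_iff hX (hT.subset_ground hf)).2 (Or.inr ⟨hF', fun f' hf' ↦ ?_⟩)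
  obtain h1 | ⟨-, h1⟩ := (hT.mem_closure_iff hX (hV.subset_ground hf')).1 (h hf')
  · exact M.closure_subset_closure (Set.subset_insert _ _) h1
  by_cases hfX' : f' ∈ M.closure X
  · exact M.closure_subset_closure (Set.subset_insert _ _) hfX'
  exact (closure_exchange ⟨h1 hf, hfX⟩).1

/-- The two sides are the total rank losses at `X` for the two orders of truncation. -/
lemma IsTrunc.boolNat_comm [M.Finite] (hT : M.IsTrunc F T) (hV : M.IsTrunc F' V) (hX : X ⊆ M.E) :
    boolNat (F ⊆ M.closure X) + boolNat (F' ⊆ T.closure X) =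
      boolNat (F' ⊆ M.closure X) + boolNat (F ⊆ V.closure X) := by
  have hnot : ∀ {F F' : Set α} {T : Matroid α}, M.IsTrunc F T → F' ⊆ M.E → F ⊆ M.closure X →
      ¬ F' ⊆ M.closure X → ¬ F' ⊆ T.closure X := by
    intro F F' T hT hF' h h' hcon
    refine h' fun f hf ↦ ?_
    obtain h1 | ⟨h1, -⟩ := (hT.mem_closure_iff hX (hF' hf)).1 (hcon hf)
    · exact h1
    · exact absurd h h1
  by_cases hF : F ⊆ M.closure X <;> by_cases hF' : F' ⊆ M.closure X
  · rw [boolNat_true hF, boolNat_true hF', boolNat_true (hF.trans (hV.closure_subset hX)),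
      boolNat_true (hF'.trans (hT.closure_subset hX))]
  · rw [boolNat_true hF, boolNat_false hF', boolNat_true (hF.trans (hV.closure_subset hX)),
      boolNat_false (hnot hT hV.subset_ground hF hF')]
  · rw [boolNat_false hF, boolNat_true hF', boolNat_true (hF'.trans (hT.closure_subset hX)),
      boolNat_false (hnot hV hT.subset_ground hF' hF)]
  · rw [boolNat_false hF, boolNat_false hF',
      boolNat_congr ⟨hT.subset_closure_comm hV hX hF', hV.subset_closure_comm hT hX hF⟩]

/-- Truncations along two sets commute. -/
lemma IsTrunc.comm [M.Finite] (hT : M.IsTrunc F T) (hU : T.IsTrunc F' U) (hV : M.IsTrunc F' V) :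
    V.IsTrunc F U := by
  refine ⟨hV.ground_eq ▸ hT.subset_ground, by rw [hU.ground_eq, hT.ground_eq, hV.ground_eq],
    fun X hX ↦ ?_⟩
  rw [hV.ground_eq] at hX
  have h1 := hT.rankOf_add X hX
  have h2 := hU.rankOf_add X (hT.ground_eq ▸ hX)
  have h3 := hV.rankOf_add X hX
  have h4 := hT.boolNat_comm hV hX
  have h5 := hT.boolNat_comm hV (Set.empty_subset _)
  omega

/-- `Y` spans `e` but not `e'`, and `Y'` spans `e'` but not `e`. -/
structure IsSide (R : Matroid α) (e e' : α) (Y Y' : Set α) : Prop where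
  mem : e ∈ R.closure Y
  notMem : e' ∉ R.closure Y
  mem' : e' ∈ R.closure Y'
  notMem' : e ∉ R.closure Y'

namespace IsSide

lemma symm (h : R.IsSide e e' Y Y') : R.IsSide e' e Y' Y := ⟨h.mem', h.notMem', h.mem, h.notMem⟩

lemma mem_ground (h : R.IsSide e e' Y Y') : e ∈ R.E := mem_ground_of_mem_closure h.mem

lemma notMem_closure_empty (h : R.IsSide e e' Y Y') : e ∉ R.closure ∅ :=
  fun h' ↦ h.notMem' (R.closure_subset_closure (Set.empty_subset _) h')

lemma isNonloop (h : R.IsSide e e' Y Y') : R.IsNonloop e :=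
  (not_isLoop_iff h.mem_ground).1 h.notMem_closure_empty

lemma notMem_closure_singleton (h : R.IsSide e e' Y Y') : e' ∉ R.closure {e} := fun h' ↦
  h.notMem (R.closure_subset_closure_of_subset_closure (Set.singleton_subset_iff.2 h.mem) h')

lemma ne (h : R.IsSide e e' Y Y') : e ≠ e' := by
  rintro rfl
  exact h.notMem h.mem

end IsSide

section Glue

variable [R.Finite] [G.Finite]

lemma IsSide.not_subset_closure_sum (hR : R.IsSide e e' Y Y') (hS : R.IsSum G S) :
    ¬ {e, g} ⊆ S.closure ∅ := by
  intro h
  have := h (Set.mem_insert _ _)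
  rw [← Set.union_self ∅, hS.mem_closure_iff (Set.empty_subset _) (Set.empty_subset _)
    hR.mem_ground] at this
  exact hR.notMem_closure_empty this

/-- As `g'` is not a loop, `X` could span it after the truncation only if `g` were spanned by `g'`
in `G`, which the sides forbid. -/
lemma IsSum.not_subset_closure_trunc (hS : R.IsSum G S)
    (hG : G.IsSide g g' A B) (hT : S.IsTrunc {e, g} T) (hX : X ⊆ R.E) :
    ¬ {e', g'} ⊆ T.closure X := by
  have := hS.finite
  have hXS : X ⊆ S.E := hX.trans (hS.ground_eq ▸ Set.subset_union_left)
  intro h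
  have h1 := h (Set.mem_insert_of_mem _ rfl)
  have hg'S : g' ∈ S.E := hS.ground_eq ▸ Or.inr hG.symm.mem_ground
  rw [hT.mem_closure_iff hXS hg'S, ← Set.union_singleton (s := X)] at h1
  obtain h1 | ⟨-, h1⟩ := h1
  · rw [← Set.union_empty X, hS.mem_closure_iff' hX (Set.empty_subset _) hG.symm.mem_ground] at h1
    exact hG.symm.notMem_closure_empty h1
  · have h2 := h1 (Set.mem_insert_of_mem _ rfl)
    rw [hS.mem_closure_iff' hX (Set.singleton_subset_iff.2 hG.symm.mem_ground) hG.mem_ground] at h2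
    exact hG.symm.notMem_closure_singleton h2

variable (hS : R.IsSum G S) (hR : R.IsSide e e' Y Y') (hG : G.IsSide g g' A B)
  (hT : S.IsTrunc {e, g} T) (hU : T.IsTrunc {e', g'} U)

include hS hR hG hT hU

/-- A subset of `R.E` spans neither pair at the moment of its truncation, so no rank is lost and `R`
survives as a restriction. -/
lemma rankOf_glue_left (hX : X ⊆ R.E) : U.rankOf X = R.rankOf X := by
  have := hS.finite
  have hXS : X ⊆ S.E := hX.trans (hS.ground_eq ▸ Set.subset_union_left)
  have h1 := hT.rankOf_add X hXS
  have h2 := hU.rankOf_add X (hT.ground_eq ▸ hXS)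
  rw [boolNat_false (hS.not_subset_closure_trunc hG hT hX),
    boolNat_false (hS.not_subset_closure_trunc hG hT (Set.empty_subset _))] at h2
  have h3 : ¬ {e, g} ⊆ S.closure X := by
    intro h
    have := h (Set.mem_insert_of_mem _ rfl)
    rw [← Set.union_empty X, hS.mem_closure_iff' hX (Set.empty_subset _) hG.mem_ground] at this
    exact hG.notMem_closure_empty this
  rw [boolNat_false h3, boolNat_false (hR.not_subset_closure_sum hS)] at h1
  have h4 := hS.rankOf_union X hX ∅ (Set.empty_subset _)
  rw [Set.union_empty, rankOf_empty] at h4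
  omega

lemma rankOf_glue_right (hX : X ⊆ G.E) : U.rankOf X = G.rankOf X := by
  rw [Set.pair_comm] at hT hU
  exact rankOf_glue_left hS.symm hG hR hT hU hX

/-- The first truncation costs one. Since `{e, g}` is already spanned, that truncation adds nothing
to the closure, so the second pair stays unspanned. -/
lemma rankOf_glue_one (hX : X ⊆ R.E) (hK : K ⊆ G.E) (he : e ∈ R.closure X) (hg : g ∈ G.closure K)
    (h : ¬ (e' ∈ R.closure X ∧ g' ∈ G.closure K)) :
    U.rankOf (X ∪ K) + 1 = R.rankOf X + G.rankOf K := by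
  have := hS.finite
  have hXS : X ∪ K ⊆ S.E := hS.ground_eq ▸ Set.union_subset_union hX hK
  have h1 := hT.rankOf_add _ hXS
  have h2 := hU.rankOf_add _ (hT.ground_eq ▸ hXS)
  have h3 : {e, g} ⊆ S.closure (X ∪ K) := Set.pair_subset_iff.2
    ⟨(hS.mem_closure_iff hX hK hR.mem_ground).2 he, (hS.mem_closure_iff' hX hK hG.mem_ground).2 hg⟩
  rw [boolNat_true h3, boolNat_false (hR.not_subset_closure_sum hS)] at h1
  have h4 : ¬ {e', g'} ⊆ T.closure (X ∪ K) := by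
    intro h'
    rw [Set.pair_subset_iff] at h'
    rw [hT.mem_closure_iff hXS (hS.ground_eq ▸ Or.inl hR.symm.mem_ground),
      hT.mem_closure_iff hXS (hS.ground_eq ▸ Or.inr hG.symm.mem_ground),
      hS.mem_closure_iff hX hK hR.symm.mem_ground,
      hS.mem_closure_iff' hX hK hG.symm.mem_ground] at h'
    tauto
  rw [boolNat_false h4,
    boolNat_false (hS.not_subset_closure_trunc hG hT (Set.empty_subset _))] at h2
  have h5 := hS.rankOf_union X hX K hK
  omega

lemma rankOf_glue_two (hX : X ⊆ R.E) (hK : K ⊆ G.E) (he : e ∈ R.closure X) (hg : g ∈ G.closure K)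
    (he' : e' ∈ R.closure X) (hg' : g' ∈ G.closure K) :
    U.rankOf (X ∪ K) + 2 = R.rankOf X + G.rankOf K := by
  have := hS.finite
  have hXS : X ∪ K ⊆ S.E := hS.ground_eq ▸ Set.union_subset_union hX hK
  have h1 := hT.rankOf_add _ hXS
  have h2 := hU.rankOf_add _ (hT.ground_eq ▸ hXS)
  have h3 : {e, g} ⊆ S.closure (X ∪ K) := Set.pair_subset_iff.2
    ⟨(hS.mem_closure_iff hX hK hR.mem_ground).2 he, (hS.mem_closure_iff' hX hK hG.mem_ground).2 hg⟩
  have h4 : {e', g'} ⊆ T.closure (X ∪ K) := (Set.pair_subset_iff.2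
    ⟨(hS.mem_closure_iff hX hK hR.symm.mem_ground).2 he',
      (hS.mem_closure_iff' hX hK hG.symm.mem_ground).2 hg'⟩).trans (hT.closure_subset hXS)
  rw [boolNat_true h3, boolNat_false (hR.not_subset_closure_sum hS)] at h1
  rw [boolNat_true h4,
    boolNat_false (hS.not_subset_closure_trunc hG hT (Set.empty_subset _))] at h2
  have h5 := hS.rankOf_union X hX K hK
  omega

/-- Local connectivity counts the identified points spanned from both sides: two for `Q` and `K`,
but one when `Y` replaces `Q` or `A` replaces `K`, as `Y` misses `e'` and `A` misses `g'`. The set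
`Q` is left general so that the lemma applies again once one point is back. -/
lemma glue_isPinnedExtension (hQ : Q ⊆ R.E) (heQ : e ∉ Q) (hYQ : Y ⊆ Q) (hYQ' : Y' ⊆ Q)
    (hQ3 : 3 ≤ Q.encard) (hK : K ⊆ G.E) (hAK : A ⊆ K) (hBK : B ⊆ K) (hK3 : 3 ≤ K.encard) :
    (U ↾ insert e (Q ∪ K)).IsPinnedExtension e := by
  have := hS.finite
  have := hT.finite
  have := hU.finite
  have heR := hR.mem_ground
  have heG : e ∉ G.E := hS.disjoint.notMem_of_mem_left heR
  have heQK : e ∉ Q ∪ K := by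
    rintro (h | h)
    · exact heQ h
    · exact heG (hK h)
  have hleft := fun {X : Set α} (hX : X ⊆ R.E) ↦ rankOf_glue_left hS hR hG hT hU hX
  have hright := fun {X : Set α} (hX : X ⊆ G.E) ↦ rankOf_glue_right hS hR hG hT hU hX
  have hdel : (U ↾ insert e (Q ∪ K)) ＼ {e} = U ↾ (Q ∪ K) := by
    rw [delete_eq_restrict, restrict_ground_eq, Set.insert_sdiff_self_of_notMem heQK,
      restrict_restrict_eq _ (Set.subset_insert _ _)]
  have hcQ := R.closure_subset_closure hYQ hR.mem
  have hcQ' := R.closure_subset_closure hYQ' hR.mem'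
  have hcK := G.closure_subset_closure hAK hG.mem
  have hcK' := G.closure_subset_closure hBK hG.mem'
  have hYR := hYQ.trans hQ
  have hAG := hAK.trans hK
  have hconn : ∀ X Z, X ⊆ Q → Z ⊆ K → (U ↾ (Q ∪ K)).localConn X Z =
      (R.rankOf X : ℤ) + G.rankOf Z - U.rankOf (X ∪ Z) := by
    intro X Z hX hZ
    rw [localConn, rankOf_restrict _ (hX.trans Set.subset_union_left),
      rankOf_restrict _ (hZ.trans Set.subset_union_right),
      rankOf_restrict _ (Set.union_subset_union hX hZ), hleft (hX.trans hQ), hright (hZ.trans hK)]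
  have hmem : ∀ X, X ⊆ Q ∪ K → U.rankOf (insert e X) = U.rankOf X →
      e ∈ (U ↾ insert e (Q ∪ K)).closure X := by
    intro X hX h
    have hfin : (U ↾ insert e (Q ∪ K)).RankFinite := inferInstance
    rw [mem_closure_iff_rankOf _ (by simp), rankOf_restrict _ (Set.insert_subset_insert hX),
      rankOf_restrict _ (hX.trans (Set.subset_insert _ _)), h]
  refine ⟨?_, Q, K, Y, A, ?_, hYQ, hAK, ?_, ?_, ?_, ?_⟩
  · rw [rankOf_pair_nonloop, rankOf_restrict _ (by simp), hleft (by simpa using heR),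
      ← rankOf_pair_nonloop]
    exact hR.isNonloop
  · rw [hdel]
    refine ⟨rfl, hS.disjoint.mono hQ hK, hQ3, hK3, ?_⟩
    rw [hconn Q K subset_rfl subset_rfl]
    have := rankOf_glue_two hS hR hG hT hU hQ hK hcQ hcK hcQ' hcK'
    omega
  · rw [hdel, hconn Y K hYQ subset_rfl]
    have := rankOf_glue_one hS hR hG hT hU hYR hK hR.mem hcK fun h ↦ hR.notMem h.1
    omega
  · rw [hdel, hconn Q A subset_rfl hAK]
    have := rankOf_glue_one hS hR hG hT hU hQ hAG hcQ hG.mem fun h ↦ hG.notMem h.2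
    omega
  · refine hmem Y (hYQ.trans Set.subset_union_left) ?_
    rw [hleft (Set.insert_subset heR hYR), hleft hYR, rankOf_insert_of_mem_closure _ hR.mem]
  · refine hmem A (hAK.trans Set.subset_union_right) ?_
    have h1 := rankOf_glue_one hS hR hG hT hU (Set.singleton_subset_iff.2 heR) hAG
      (R.mem_closure_self e heR) hG.mem fun h ↦ hG.notMem h.2
    rw [rankOf_pair_nonloop.1 hR.isNonloop, Set.singleton_union] at h1
    rw [hright hAG]
    omega

end Glue

end Matroid

/-! ### Gluing when one of the two points is freer -/

namespace Matroid

variable {α : Type*} {R H S T : Matroid α} {X Y Z : Set α} {e e' g g' p : α}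

lemma IsTrunc.mem_closure_of_mem_closure_singleton [R.Finite] [H.Finite] (hS : R.IsSum H S)
    (hT : S.IsTrunc {e', g'} T) (he' : R.IsNonloop e') (hg' : g' ∈ H.E)
    (h : g' ∈ T.closure X) : e' ∈ T.closure X := by
  have := hS.finite
  refine T.closure_subset_closure_of_subset_closure (Set.singleton_subset_iff.2 h) ?_
  have hE : {g'} ⊆ H.E := Set.singleton_subset_iff.2 hg'
  have hE' : {g'} ⊆ S.E := hE.trans (hS.ground_eq ▸ Set.subset_union_right)
  have he'S : e' ∈ S.E := hS.ground_eq ▸ Or.inl he'.mem_ground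
  refine (hT.mem_closure_iff hE' he'S).2 (Or.inr ⟨fun h' ↦ ?_, ?_⟩)
  · have := h' (Set.mem_insert _ _)
    rw [← Set.empty_union {g'}, hS.mem_closure_iff (Set.empty_subset _) hE he'.mem_ground] at this
    exact he'.not_isLoop this
  · exact S.subset_closure _ (Set.insert_subset he'S hE')

/-- If the point `g` is freer than `g'` in `H`, then gluing `R` and `H` along the pairs
`e, g` and `e', g'` amounts to identifying `e'` with `g'` and placing the span of `g` and `g'`
freely on a line through this point. -/
lemma IsTrunc.pair_subset_closure_iff [R.Finite] [H.Finite] (hS : R.IsSum H S)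
    (hT : S.IsTrunc {e', g'} T) (he' : R.IsNonloop e')
    (he : e ∈ R.E) (hg : g ∈ H.E) (hg' : g' ∈ H.E)
    (hp : p ∈ R.closure {e, e'}) (hep : e ∈ R.closure {p, e'}) (hY : Y ⊆ R.E) (hZ : Z ⊆ H.E)
    (hfree : g ∈ H.closure Z → g' ∈ H.closure Z) :
    {e, g} ⊆ T.closure (Y ∪ Z) ↔ {p, g, g'} ⊆ T.closure (Y ∪ Z) := by
  have := hS.finite
  have hYZ : Y ∪ Z ⊆ S.E := hS.ground_eq ▸ Set.union_subset_union hY hZ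
  have hpR := mem_ground_of_mem_closure hp
  have hgS : g ∈ S.E := hS.ground_eq ▸ Or.inr hg
  have hg'S : g' ∈ S.E := hS.ground_eq ▸ Or.inr hg'
  have hRS : R.E ⊆ S.E := hS.ground_eq ▸ Set.subset_union_left
  have hlift : ∀ {x y}, y ∈ R.E → x ∈ R.closure {y, e'} → y ∈ T.closure (Y ∪ Z) →
      e' ∈ T.closure (Y ∪ Z) → x ∈ T.closure (Y ∪ Z) := by
    intro x y hy hx hyT he'T
    refine T.closure_subset_closure_of_subset_closure (Set.pair_subset_iff.2 ⟨hyT, he'T⟩) ?_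
    have hsub : {y, e'} ⊆ R.E := Set.pair_subset_iff.2 ⟨hy, he'.mem_ground⟩
    refine hT.closure_subset (hsub.trans hRS) ?_
    rw [← Set.union_empty {y, e'}, hS.mem_closure_iff hsub (Set.empty_subset _)
      (mem_ground_of_mem_closure hx)]
    exact hx
  have hpar := hT.mem_closure_of_mem_closure_singleton (X := Y ∪ Z) hS he' hg'
  simp only [Set.insert_subset_iff, Set.singleton_subset_iff]
  constructor
  · rintro ⟨heT, hgT⟩
    -- If `g` was spanned before the truncation, use `hfree`. Otherwise `g` completes the pair `{e',
    -- g'}`; in a direct sum this forces `Y` to span `e'` already, so `g'` completes the pair as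
    -- well.
    have hg'T : g' ∈ T.closure (Y ∪ Z) := by
      obtain h1 | ⟨h1, h2⟩ := (hT.mem_closure_iff hYZ hgS).1 hgT
      · rw [hS.mem_closure_iff' hY hZ hg] at h1
        exact hT.closure_subset hYZ ((hS.mem_closure_iff' hY hZ hg').2 (hfree h1))
      refine (hT.mem_closure_iff hYZ hg'S).2 (Or.inr ⟨h1, Set.pair_subset_iff.2 ⟨?_, ?_⟩⟩)
      · have := h2 (Set.mem_insert _ _)
        rw [← Set.union_insert, hS.mem_closure_iff hY (Set.insert_subset hg hZ)
          he'.mem_ground] at this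
        rw [← Set.union_insert, hS.mem_closure_iff hY (Set.insert_subset hg' hZ) he'.mem_ground]
        exact this
      · exact S.mem_closure_of_mem (Set.mem_insert _ _) (Set.insert_subset hg'S hYZ)
    exact ⟨hlift he hp heT (hpar hg'T), hgT, hg'T⟩
  · rintro ⟨hpT, hgT, hg'T⟩
    exact ⟨hlift hpR hep hpT (hpar hg'T), hgT⟩

end Matroid

namespace MatroidClass

open Matroid

variable {𝓜 : MatroidClass.{u}} {β : Type u} {R H S T U : Matroid β} {e e' g g' p : β}

/-- Truncating along `{p, g, g'}` instead of `{e, g}` has the same effect on sets that avoid the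
four deleted points. It can be done in `T ＼ {e}`, so only `R ＼ {e}` has to be in the class. -/
lemma IsNatural.glue_mem [Infinite β] [R.Finite] (h : 𝓜.IsNatural) (hS : R.IsSum H S)
    (hT : S.IsTrunc {e', g'} T) (hU : T.IsTrunc {e, g} U) (hR : 𝓜.Mem (R ＼ {e}))
    (hH : 𝓜.Mem H) (he' : R.IsNonloop e') (he : e ∈ R.E) (hee' : e ≠ e') (hpe : p ≠ e)
    (hg : g ∈ H.E) (hg' : g' ∈ H.E) (hp : p ∈ R.closure {e, e'}) (hep : e ∈ R.closure {p, e'})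
    (hfree : ∀ X ⊆ H.E \ {g, g'}, g ∈ H.closure X → g' ∈ H.closure X) :
    𝓜.Mem (U ＼ ({e, e'} ∪ {g, g'})) := by
  have := 𝓜.finite_of_mem _ hH
  have := hS.finite
  have := hT.finite
  have := hU.finite
  have heH : e ∉ H.E := hS.disjoint.notMem_of_mem_left he
  have hS' := hS.delete_left (Set.disjoint_singleton_left.2 heH)
  have hge : g ≠ e := fun h ↦ heH (h ▸ hg)
  have hge' : g' ≠ e := fun h ↦ heH (h ▸ hg')
  have hT' := hT.delete (D := {e}) (by simp [hee', hge'.symm])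
  have hmemT := h.trunc (h.sum hR hH hS') hT'
  have := 𝓜.finite_of_mem _ hmemT
  have hTE : T.E = R.E ∪ H.E := hT.ground_eq.trans hS.ground_eq
  have hF : {p, g, g'} ⊆ (T ＼ {e}).E := by
    rw [delete_ground, hTE]
    simp [Set.insert_subset_iff, hpe, hge, hge', hg, hg', mem_ground_of_mem_closure hp]
  have hFe : Disjoint ({p, g, g'} : Set β) {e} := by simp [hpe.symm, hge.symm, hge'.symm]
  obtain ⟨U', hU'⟩ := exists_isTrunc (T ＼ {e}) hF
  have hmemU := h.trunc hmemT hU'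
  have := hU'.finite
  have hdE : (U ＼ ({e, e'} ∪ {g, g'})).E = (U' ＼ ({e, e'} ∪ {g, g'})).E := by
    rw [delete_ground, delete_ground, hU.ground_eq, hU'.ground_eq, delete_ground]
    ext x
    simp only [Set.mem_sdiff, Set.mem_union, Set.mem_insert_iff, Set.mem_singleton_iff]
    tauto
  have hiff : ∀ X ⊆ (U ＼ ({e, e'} ∪ {g, g'})).E,
      {e, g} ⊆ T.closure X ↔ {p, g, g'} ⊆ (T ＼ {e}).closure X := by
    intro X hX
    have hXT : X ⊆ R.E ∪ H.E := by
      rw [← hTE, ← hU.ground_eq]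
      exact hX.trans Set.sdiff_subset
    have heX : Disjoint X {e} := Set.disjoint_singleton_right.2 fun h ↦ (hX h).2 (by simp)
    rw [T.subset_closure_delete_iff heX hFe]
    have hXe : X = (X ∩ R.E) ∪ (X ∩ H.E) := by
      rw [← Set.inter_union_distrib_left, Set.inter_eq_self_of_subset_left hXT]
    rw [hXe]
    refine hT.pair_subset_closure_iff hS he' he hg hg' hp hep Set.inter_subset_right
      Set.inter_subset_right (hfree _ fun x hx ↦ ⟨hx.2, fun h ↦ (hX hx.1).2 (Or.inr h)⟩)
  have heq : U ＼ ({e, e'} ∪ {g, g'}) = U' ＼ ({e, e'} ∪ {g, g'}) := by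
    refine ext_rankOf hdE fun X hX ↦ ?_
    have hXd : Disjoint X ({e, e'} ∪ {g, g'}) := Set.disjoint_sdiff_left.mono_left hX
    have heX : Disjoint X {e} := hXd.mono_right (by simp)
    have hXU : X ⊆ T.E := hU.ground_eq ▸ hX.trans Set.sdiff_subset
    have hXT : X ⊆ (T ＼ {e}).E := Set.subset_sdiff.2 ⟨hXU, heX⟩
    rw [rankOf_delete _ hXd, rankOf_delete _ hXd]
    have h1 := hU.rankOf_add X hXU
    have h2 := hU'.rankOf_add X hXT
    rw [rankOf_delete _ heX] at h2
    rw [boolNat_congr (hiff X hX), boolNat_congr (hiff ∅ (Set.empty_subset _))] at h1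
    omega
  rw [heq]
  exact h.delete hmemU _

end MatroidClass

/-! ### Gadgets, obstructions and the excluded minor -/

namespace Matroid

variable {α : Type*} {M R G H S T U : Matroid α} {A B X Y Y' : Set α} {e e' f g g' p : α}

/-- Every set avoiding both `g` and `g'` that spans `g` also spans `g'`. -/
def IsFreer (H : Matroid α) (g g' : α) : Prop :=
  ∀ X ⊆ H.E \ {g, g'}, g ∈ H.closure X → g' ∈ H.closure X

/-- `G` consists of `A ∪ B` together with two points `g` and `g'` such that deleting or contracting
any element of `A ∪ B` makes one of `g` and `g'` freer than the other. -/
structure IsGadget (G : Matroid α) (g g' : α) (A B : Set α) : Prop where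
  side : G.IsSide g g' A B
  union_eq : A ∪ B = G.E \ {g, g'}
  three_le : 3 ≤ (A ∪ B).encard
  freer_delete : ∀ f ∈ A ∪ B, (G ＼ {f}).IsFreer g g' ∨ (G ＼ {f}).IsFreer g' g
  freer_contract : ∀ f ∈ A ∪ B, (G ／ {f}).IsFreer g g' ∨ (G ／ {f}).IsFreer g' g

lemma restrict_insert_delete (M : Matroid α) (he : e ∉ X) : (M ↾ insert e X) ＼ {e} = M ↾ X := by
  rw [delete_eq_restrict, restrict_ground_eq, Set.insert_sdiff_self_of_notMem he,
    restrict_restrict_eq _ (Set.subset_insert _ _)]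

end Matroid

namespace MatroidClass

open Matroid

variable {𝓜 𝓜₁ 𝓜₂ : MatroidClass.{u}} {β : Type u} {M R G H S T U : Matroid β}
  {A B X Y Y' : Set β} {e e' f g g' p : β}

lemma IsNatural.restrict (h : 𝓜.IsNatural) (hM : 𝓜.Mem M) (hX : X ⊆ M.E) : 𝓜.Mem (M ↾ X) := by
  rw [← delete_compl hX]
  exact h.delete hM _

lemma exists_isExcludedMinor [hM : M.Finite] (h : ¬ 𝓜.Mem M) :
    ∃ L, L ≤m M ∧ 𝓜.IsExcludedMinor L := by
  induction hn : M.E.ncard using Nat.strong_induction_on generalizing M with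
  | _ n ih =>
  by_cases hall : ∀ N : Matroid β, N.IsStrictMinor M → 𝓜.Mem N
  · exact ⟨M, IsMinor.refl, hM, h, hall⟩
  push Not at hall
  obtain ⟨N, hNM, hN⟩ := hall
  have : N.Finite := ⟨hM.ground_finite.subset hNM.ssubset.subset⟩
  obtain ⟨L, hL, hL'⟩ := ih N.E.ncard (hn ▸ Set.ncard_lt_ncard hNM.ssubset hM.ground_finite) hN rfl
  exact ⟨L, hL.trans hNM.isMinor, hL'⟩

/-- `R` is not in the class, but all single-element deletions and contractions are, except for the
deletion of a point `p` on the line through two incomparable points `e` and `e'` and the contraction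
of `e` and `e'`. -/
structure IsObstruction (𝓜 : MatroidClass.{u}) (R : Matroid β) (e e' p : β) (Y Y' : Set β) :
    Prop where
  side : R.IsSide e e' Y Y'
  subset : Y ⊆ R.E \ {e, e'}
  subset' : Y' ⊆ R.E \ {e, e'}
  mem : p ∈ R.E \ {e, e'}
  mem_closure : p ∈ R.closure {e, e'}
  mem_closure_left : e ∈ R.closure {p, e'}
  mem_closure_right : e' ∈ R.closure {p, e}
  three_le : 3 ≤ (R.E \ {e, e'}).encard
  notMem : ¬ 𝓜.Mem R
  mem_delete : ∀ f ∈ R.E, f ≠ p → 𝓜.Mem (R ＼ {f})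
  mem_contract : ∀ f ∈ R.E \ {e, e'}, 𝓜.Mem (R ／ {f})

/-- Truncations commute, so the one at the freer of `g` and `g'` can be performed last. -/
lemma IsObstruction.glue_mem [Infinite β] [R.Finite] (h : 𝓜.IsNatural)
    (hR : 𝓜.IsObstruction R e e' p Y Y') (hS : R.IsSum H S) (hT : S.IsTrunc {e, g} T)
    (hU : T.IsTrunc {e', g'} U) (hH : 𝓜.Mem H) (hg : g ∈ H.E) (hg' : g' ∈ H.E)
    (hfree : H.IsFreer g g' ∨ H.IsFreer g' g) : 𝓜.Mem (U ＼ ({e, e'} ∪ {g, g'})) := by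
  have := 𝓜.finite_of_mem _ hH
  have := hS.finite
  have hpe : p ≠ e := fun h ↦ hR.mem.2 (by simp [h])
  have hpe' : p ≠ e' := fun h ↦ hR.mem.2 (by simp [h])
  have he := hR.side.mem_ground
  have he' := hR.side.symm.mem_ground
  obtain hf | hf := hfree
  · obtain ⟨V, hV⟩ := S.exists_isTrunc (F := {e', g'})
      (by simp [hS.ground_eq, Set.insert_subset_iff, he', hg'])
    exact h.glue_mem hS hV (hT.comm hU hV) (hR.mem_delete e he hpe.symm) hH hR.side.symm.isNonloop
      he hR.side.ne hpe hg hg' hR.mem_closure hR.mem_closure_left hf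
  · rw [Set.pair_comm e e', Set.pair_comm g g']
    exact h.glue_mem hS hT hU (hR.mem_delete e' he' hpe'.symm) hH hR.side.isNonloop
      he' hR.side.ne.symm hpe' hg' hg (Set.pair_comm e e' ▸ hR.mem_closure) hR.mem_closure_right
      hf

/-- Gluing an obstruction to a gadget does not give a member of the class. -/
lemma IsObstruction.glue_notMem [R.Finite] [G.Finite] [Infinite β] (h : 𝓜.IsNatural)
    (hpin : 𝓜.ClosedUnderPinnedExtensions) (hR : 𝓜.IsObstruction R e e' p Y Y')
    (hG : G.IsGadget g g' A B) (hS : R.IsSum G S) (hT : S.IsTrunc {e, g} T)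
    (hU : T.IsTrunc {e', g'} U) : ¬ 𝓜.Mem (U ↾ (R.E \ {e, e'} ∪ (A ∪ B))) := by
  have := hS.finite
  have := hT.finite
  have := hU.finite
  intro hmem
  have he := hR.side.mem_ground
  have he' := hR.side.symm.mem_ground
  have hK : A ∪ B ⊆ G.E := hG.union_eq ▸ Set.sdiff_subset
  have heK : e ∉ A ∪ B := fun h ↦ hS.disjoint.notMem_of_mem_left he (hK h)
  have heK' : e' ∉ A ∪ B := fun h ↦ hS.disjoint.notMem_of_mem_left he' (hK h)
  obtain ⟨V, hV⟩ := S.exists_isTrunc (F := {e', g'})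
    (by simp [hS.ground_eq, Set.insert_subset_iff, he', hG.side.symm.mem_ground])
  have hp1 := glue_isPinnedExtension hS hR.side hG.side hT hU (Q := R.E \ {e, e'}) (K := A ∪ B)
    Set.sdiff_subset (by simp) hR.subset hR.subset' hR.three_le hK Set.subset_union_left
    Set.subset_union_right hG.three_le
  have hm1 := hpin _ _ e (by
    rwa [restrict_insert_delete _ (by simp [heK])]) hp1
  have hee' := hR.side.ne
  -- For the second point the roles of the pairs are exchanged, and `e` has joined the side of `R`
  -- in the separation.
  have hp2 := glue_isPinnedExtension hS hR.side.symm hG.side.symm hV (hT.comm hU hV)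
    (Q := insert e (R.E \ {e, e'})) (K := A ∪ B)
    (Set.insert_subset he Set.sdiff_subset) (by simp [hee'.symm])
    (hR.subset'.trans (Set.subset_insert _ _)) (hR.subset.trans (Set.subset_insert _ _))
    (hR.three_le.trans (Set.encard_le_encard (Set.subset_insert _ _))) hK Set.subset_union_right
    Set.subset_union_left hG.three_le
  have hm2 := hpin _ _ e' (by
    rwa [restrict_insert_delete _ (by simp [heK', hee'.symm]), Set.insert_union]) hp2
  have hRsub : R.E ⊆ insert e' (insert e (R.E \ {e, e'}) ∪ (A ∪ B)) := by
    intro x hx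
    simp only [Set.mem_insert_iff, Set.mem_union, Set.mem_sdiff, Set.mem_singleton_iff]
    tauto
  have hm3 := h.restrict hm2 (X := R.E) hRsub
  rw [restrict_restrict_eq _ hRsub] at hm3
  have := 𝓜.finite_of_mem _ hm3
  refine hR.notMem ?_
  rwa [← ext_rankOf (M := U ↾ R.E) (N := R) rfl fun X hX ↦ ?_]
  rw [restrict_ground_eq] at hX
  rw [rankOf_restrict _ hX, rankOf_glue_left hS hR.side hG.side hT hU hX]

/-- Deleting `p` from the glued matroid is not controlled, so that matroid need not itself be an
excluded minor; but `p` is the only element that an excluded minor inside it can lack. -/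
lemma IsObstruction.exists_isExcludedMinor [R.Finite] [Infinite β] (h₁ : 𝓜₁.IsNatural)
    (h₂ : 𝓜₂.IsNatural) (hpin : 𝓜₁.ClosedUnderPinnedExtensions)
    (hR : 𝓜₁.IsObstruction R e e' p Y Y') (hG : G.IsGadget g g' A B) (hd : Disjoint R.E G.E)
    (hR₂ : 𝓜₂.Mem R) (hG₁ : 𝓜₁.Mem G) (hG₂ : 𝓜₂.Mem G) :
    ∃ L, 𝓜₁.IsExcludedMinor L ∧ 𝓜₂.Mem L ∧ G ↾ (A ∪ B) ≤m L := by
  have := 𝓜₂.finite_of_mem _ hG₂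
  have hS := isSum_disjointSum hd
  set S := R.disjointSum G hd
  have := hS.finite
  have he := hR.side.mem_ground
  have he' := hR.side.symm.mem_ground
  have hg := hG.side.mem_ground
  have hg' := hG.side.symm.mem_ground
  have hK : A ∪ B ⊆ G.E := hG.union_eq ▸ Set.sdiff_subset
  obtain ⟨T, hT⟩ := S.exists_isTrunc (F := {e, g})
    (by simp [hS.ground_eq, Set.insert_subset_iff, he, hg])
  have := hT.finite
  obtain ⟨U, hU⟩ := T.exists_isTrunc (F := {e', g'})
    (by simp [hT.ground_eq, hS.ground_eq, Set.insert_subset_iff, he', hg'])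
  have := hU.finite
  have hUE : U.E = R.E ∪ G.E := by rw [hU.ground_eq, hT.ground_eq, hS.ground_eq]
  have hrestr : U ＼ ({e, e'} ∪ {g, g'}) = U ↾ (R.E \ {e, e'} ∪ (A ∪ B)) := by
    rw [delete_eq_restrict, hUE, hG.union_eq]
    congr 1
    ext x
    have h1 : x ∈ R.E → x ∉ G.E := fun h ↦ hd.notMem_of_mem_left h
    have h2 : x = e → x ∈ R.E := fun h ↦ h ▸ he
    have h3 : x = e' → x ∈ R.E := fun h ↦ h ▸ he'
    have h4 : x = g → x ∈ G.E := fun h ↦ h ▸ hg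
    have h5 : x = g' → x ∈ G.E := fun h ↦ h ▸ hg'
    simp only [Set.mem_sdiff, Set.mem_union, Set.mem_insert_iff, Set.mem_singleton_iff]
    tauto
  have hM₂ : 𝓜₂.Mem (U ＼ ({e, e'} ∪ {g, g'})) :=
    h₂.delete (h₂.trunc (h₂.trunc (h₂.sum hR₂ hG₂ hS) hT) hU) _
  have hM₁ : ¬ 𝓜₁.Mem (U ＼ ({e, e'} ∪ {g, g'})) := by
    rw [hrestr]
    exact hR.glue_notMem h₁ hpin hG hS hT hU
  have hME : (U ＼ ({e, e'} ∪ {g, g'})).E = R.E \ {e, e'} ∪ (A ∪ B) := by rw [hrestr]; rfl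
  have hfacts : ∀ f ∈ (U ＼ ({e, e'} ∪ {g, g'})).E, f ∉ ({e, g} : Set β) ∧ f ∉ ({e', g'} : Set β) ∧
      f ∉ ({e, e'} ∪ {g, g'} : Set β) := by
    intro f hf
    have := hf.2
    simp only [Set.mem_union, Set.mem_insert_iff, Set.mem_singleton_iff] at this ⊢
    tauto
  have hdel : ∀ f ∈ (U ＼ ({e, e'} ∪ {g, g'})).E, f ≠ p →
      𝓜₁.Mem ((U ＼ ({e, e'} ∪ {g, g'})) ＼ {f}) := by
    intro f hf hfp
    obtain ⟨h1, h2, -⟩ := hfacts f hf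
    have hT' := hT.delete (D := {f}) (Set.disjoint_singleton_right.2 h1)
    have hU' := hU.delete (D := {f}) (Set.disjoint_singleton_right.2 h2)
    rw [delete_comm]
    rw [hME] at hf
    obtain hf | hf := hf
    · have hS' := hS.delete_left
        (Set.disjoint_singleton_left.2 (hd.notMem_of_mem_left hf.1))
      exact h₁.delete (h₁.trunc (h₁.trunc (h₁.sum (hR.mem_delete f hf.1 hfp) hG₁ hS') hT') hU') _
    · have hS' := (hS.symm.delete_left
        (Set.disjoint_singleton_left.2 (hd.notMem_of_mem_right (hK hf)))).symm
      rw [hG.union_eq] at hf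
      refine hR.glue_mem h₁ hS' hT' hU' (h₁.delete hG₁ _) ⟨hg, fun h ↦ hf.2 (by simp_all)⟩
        ⟨hg', fun h ↦ hf.2 (by simp_all)⟩ (hG.freer_delete f (hG.union_eq ▸ hf))
  have hcon : ∀ f ∈ (U ＼ ({e, e'} ∪ {g, g'})).E, 𝓜₁.Mem ((U ＼ ({e, e'} ∪ {g, g'})) ／ {f}) := by
    intro f hf
    obtain ⟨h1, h2, h3⟩ := hfacts f hf
    have hfU : {f} ⊆ U.E := Set.singleton_subset_iff.2 hf.1
    have hT' := hT.contract (C := {f}) (by rwa [← hT.ground_eq, ← hU.ground_eq])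
      (Set.disjoint_singleton_right.2 h1)
    have hU' := hU.contract (C := {f}) (by rwa [← hU.ground_eq])
      (Set.disjoint_singleton_right.2 h2)
    rw [← contract_delete_comm _ (Set.disjoint_singleton_left.2 h3)]
    rw [hME] at hf
    obtain hf | hf := hf
    · have hS' := hS.contract_left (Set.singleton_subset_iff.2 hf.1)
      exact h₁.delete (h₁.trunc (h₁.trunc (h₁.sum (hR.mem_contract f hf) hG₁ hS') hT') hU') _
    · have hS' := (hS.symm.contract_left (Set.singleton_subset_iff.2 (hK hf))).symm
      rw [hG.union_eq] at hf
      refine hR.glue_mem h₁ hS' hT' hU' (h₁.contract hG₁ _) ⟨hg, fun h ↦ hf.2 (by simp_all)⟩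
        ⟨hg', fun h ↦ hf.2 (by simp_all)⟩ (hG.freer_contract f (hG.union_eq ▸ hf))
  obtain ⟨L, hLM, hL⟩ := MatroidClass.exists_isExcludedMinor hM₁
  refine ⟨L, hL, h₂.minor _ _ _ hM₂ hLM, ?_⟩
  obtain ⟨C, D, hC, hD, hCD, rfl⟩ := hLM.exists_eq_contract_delete_disjoint
  have hC0 : C = ∅ := by
    by_contra! hne
    obtain ⟨f, hf⟩ := hne
    refine hL.2.1 (h₁.delete ?_ D)
    rw [← Set.union_eq_self_of_subset_left (Set.singleton_subset_iff.2 hf), ← contract_contract]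
    exact h₁.contract (hcon f (hC hf)) C
  subst hC0
  rw [contract_empty] at hL ⊢
  have hKD : A ∪ B ⊆ ((U ＼ ({e, e'} ∪ {g, g'})) ＼ D).E := by
    intro f hf
    refine ⟨hME ▸ Or.inr hf, fun hfD ↦ hL.2.1 ?_⟩
    rw [← Set.union_eq_self_of_subset_left (Set.singleton_subset_iff.2 hfD), ← delete_delete]
    refine h₁.delete (hdel f (hD hfD) ?_) D
    rintro rfl
    exact hd.notMem_of_mem_left hR.mem.1 (hK hf)
  have hGU : G ↾ (A ∪ B) = ((U ＼ ({e, e'} ∪ {g, g'})) ＼ D) ↾ (A ∪ B) := by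
    have h1 := restrict_finite (M := G) (G.ground_finite.subset hK)
    have h2 := restrict_finite (M := (U ＼ ({e, e'} ∪ {g, g'})) ＼ D) (G.ground_finite.subset hK)
    refine ext_rankOf rfl fun X hX ↦ ?_
    rw [restrict_ground_eq] at hX
    have hX1 : X ⊆ ((U ＼ ({e, e'} ∪ {g, g'})) ＼ D).E := hX.trans hKD
    rw [rankOf_restrict _ hX, rankOf_restrict _ hX,
      rankOf_delete _ (Set.disjoint_sdiff_left.mono_left hX1),
      rankOf_delete _ (Set.disjoint_sdiff_left.mono_left (hX1.trans Set.sdiff_subset)),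
      rankOf_glue_right hS hR.side hG.side hT hU (hX.trans hK)]
  rw [hGU]
  exact ⟨∅, _, by rw [contract_empty, delete_compl hKD]⟩

end MatroidClass

/-! ### Comparing freedom of points, and finding an obstruction -/

namespace Matroid

variable {α : Type*} {M P : Matroid α} {F X Y Y' : Set α} {e e' f g p : α}

lemma image_swap_of_notMem [DecidableEq α] (he : e ∉ X) (hf : f ∉ X) :
    Equiv.swap e f '' X = X := by
  refine (Set.image_congr fun x hx ↦ ?_).trans (Set.image_id X)
  exact Equiv.swap_apply_of_ne_of_ne (fun h ↦ he (h ▸ hx)) (fun h ↦ hf (h ▸ hx))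

lemma isFreeExt_delete [P.Finite] (he : e ∈ P.E) (hF : F ⊆ P.E \ {e})
    (h : ∀ X ⊆ P.E \ {e}, e ∈ P.closure X ↔ F ⊆ P.closure X) :
    (P ＼ {e}).IsFreeExt F e P := by
  have hd : ∀ X ⊆ P.E \ {e}, Disjoint X {e} := fun X hX ↦ Set.disjoint_sdiff_left.mono_left hX
  refine ⟨hF, fun h ↦ h.2 rfl, by simp [he], fun X hX ↦ (rankOf_delete _ (hd X hX)).symm,
    fun X hX ↦ ?_⟩
  rw [boolNat_congr (P.subset_closure_delete_iff (hd X hX) (hd F hF)), rankOf_delete _ (hd X hX),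
    boolNat_congr (h X hX).symm]
  by_cases heX : e ∈ P.closure X
  · rw [boolNat_true heX, rankOf_insert_of_mem_closure _ heX]
  · rw [boolNat_false heX, P.rankOf_insert_of_notMem_closure he heX]

/-- The set `X` may contain the middle point `f`, so pass to a circuit `C` through `e` in `X ∪ {e}`.
If `f ∈ C`, then `C \ {f}` spans `f` and hence `g`; otherwise `C \ {e}` spans `f` and then `g`. -/
lemma IsFreer.trans (h : M.IsFreer e f) (h' : M.IsFreer f g) : M.IsFreer e g := by
  intro X hX heX
  have hXE : X ⊆ M.E := hX.trans Set.sdiff_subset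
  by_cases hge : g = e
  · exact hge ▸ heX
  have heX' : e ∉ X := fun h ↦ (hX h).2 (by simp)
  have hgX : g ∉ X := fun h ↦ (hX h).2 (by simp)
  obtain ⟨C, hCX, hC, heC⟩ := exists_isCircuit_of_mem_closure heX heX'
  have hCX' : C \ {e} ⊆ X := by rwa [Set.sdiff_singleton_subset_iff]
  have heC' := hC.mem_closure_sdiff_singleton_of_mem heC
  refine M.closure_subset_closure hCX' ?_
  by_cases hfC : f ∈ C
  · have hg := h' (C \ {f}) (Set.subset_sdiff.2 ⟨Set.sdiff_subset.trans hC.subset_ground, by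
      simp only [Set.disjoint_insert_right, Set.disjoint_singleton_right, Set.mem_sdiff,
        Set.mem_singleton_iff, not_true_eq_false, and_false, not_false_eq_true, true_and]
      exact fun h ↦ (hCX h.1).elim hge hgX⟩) (hC.mem_closure_sdiff_singleton_of_mem hfC)
    rw [closure_sdiff_singleton_eq_closure heC']
    exact M.closure_subset_closure Set.sdiff_subset hg
  · have hsub : C \ {e} ⊆ M.E := hCX'.trans hXE
    refine h' _ (Set.subset_sdiff.2 ⟨hsub, ?_⟩) (h _ (Set.subset_sdiff.2 ⟨hsub, ?_⟩) heC')
    · simp only [Set.disjoint_insert_right, Set.disjoint_singleton_right]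
      exact ⟨fun h ↦ hfC h.1, fun h ↦ hgX (hCX' h)⟩
    · simp only [Set.disjoint_insert_right, Set.disjoint_singleton_right]
      exact ⟨fun h ↦ h.2 rfl, fun h ↦ hfC h.1⟩

lemma isFreer_self (M : Matroid α) (e : α) : M.IsFreer e e := fun _ _ h ↦ h

/-- Take a point freer than as many others as possible: a point not below it would, by transitivity,
be freer than strictly more. -/
lemma exists_forall_isFreer [M.Finite] (hne : M.E.Nonempty)
    (h : ∀ e ∈ M.E, ∀ f ∈ M.E, M.IsFreer e f ∨ M.IsFreer f e) :
    ∃ e ∈ M.E, ∀ f ∈ M.E, M.IsFreer e f := by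
  obtain ⟨e, he, hmax⟩ := Set.exists_max_image M.E
    (fun e ↦ {f ∈ M.E | M.IsFreer e f}.ncard) M.ground_finite hne
  refine ⟨e, he, fun f hf ↦ by_contra fun hef ↦ ?_⟩
  have hfe := (h e he f hf).resolve_left hef
  refine (hmax f hf).not_gt (Set.ncard_lt_ncard ?_ (M.ground_finite.subset (Set.sep_subset _ _)))
  exact ⟨fun x hx ↦ ⟨hx.1, hfe.trans hx.2⟩, fun hss ↦ hef (hss ⟨hf, M.isFreer_self f⟩).2⟩

/-- The number of dependent sets. -/
noncomputable def numDep (M : Matroid α) : ℕ := {X | M.Dep X}.ncard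

lemma finite_setOf_dep (M : Matroid α) [M.Finite] : {X | M.Dep X}.Finite :=
  M.ground_finite.finite_subsets.subset fun _ h ↦ h.subset_ground

/-- Moving a point `e` onto the line through `e` and `e'` reduces the number of dependent sets. -/
lemma IsFreeExt.numDep_delete_lt [M.Finite] (hP : M.IsFreeExt {e, e'} p P)
    (hY : Y ⊆ M.E \ {e, e'}) (he : e ∈ M.closure Y) (he' : e' ∉ M.closure Y) :
    (P ＼ {e}).numDep < M.numDep := by
  classical
  have hPfin := hP.finite
  have heE := mem_ground_of_mem_closure he
  have hpe : p ≠ e := fun h ↦ hP.notMem (h ▸ heE)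
  have hdel := hP.delete_eq
  have hswap := fun (X : Set α) (heX : e ∉ X) (hpX : p ∉ X) ↦ image_swap_of_notMem hpX heX
  have hindep : ∀ X ⊆ M.E \ {e}, (P.Indep (insert p X) ↔
      M.Indep X ∧ ¬ {e, e'} ⊆ M.closure X) := by
    intro X hX
    have hXM := hX.trans Set.sdiff_subset
    have hpX : p ∉ X := fun h ↦ hP.notMem (hXM h)
    rw [insert_indep_iff, ← hdel, delete_indep_iff, hdel, Set.mem_sdiff, hP.mem_closure_iff hXM]
    simp [hpX, hP.mem_ground]
  -- Renaming `p` to `e` keeps dependent sets dependent, because a set spanning `{e, e'}` spans `e`.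
  have hsub : (Equiv.swap p e '' ·) '' {X | (P ＼ {e}).Dep X} ⊆ {X | M.Dep X} := by
    rintro _ ⟨X, hX, rfl⟩
    have heX : e ∉ X := fun h ↦ (hX.subset_ground h).2 rfl
    have hXE : X ⊆ P.E := hX.subset_ground.trans Set.sdiff_subset
    rw [hP.ground_eq] at hXE
    simp only [Set.mem_ofPred_eq, delete_dep_iff] at hX ⊢
    by_cases hpX : p ∈ X
    · obtain ⟨Z, hpZ, rfl⟩ : ∃ Z, p ∉ Z ∧ X = insert p Z := ⟨X \ {p}, by simp, by simp [hpX]⟩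
      have heZ : e ∉ Z := fun h ↦ heX (Set.mem_insert_of_mem _ h)
      have hZE : Z ⊆ M.E := fun z hz ↦ (hXE (Set.mem_insert_of_mem _ hz)).resolve_left
        (fun h ↦ hpZ (h ▸ hz))
      rw [Set.image_insert_eq, Equiv.swap_apply_left, hswap Z heZ hpZ]
      refine ⟨fun hi ↦ hX.1.not_indep ?_, Set.insert_subset heE hZE⟩
      rw [hindep Z (Set.subset_sdiff.2 ⟨hZE, Set.disjoint_singleton_right.2 heZ⟩)]
      rw [insert_indep_iff] at hi
      exact ⟨hi.1, fun h ↦ (hi.2 heZ).2 (h (Set.mem_insert _ _))⟩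
    · rw [hswap X heX hpX]
      rw [← hdel, delete_dep_iff]
      exact ⟨hX.1, Set.disjoint_singleton_right.2 hpX⟩
  -- The dependent set `insert e I` is not hit: `I` does not span `e'`, so `insert p I` is
  -- independent.
  obtain ⟨I, hI⟩ := M.exists_isBasis Y (hY.trans Set.sdiff_subset)
  have hIE : I ⊆ M.E := hI.indep.subset_ground
  have heI : e ∉ I := fun h ↦ (hY (hI.subset h)).2 (by simp)
  have hpI : p ∉ I := fun h ↦ hP.notMem (hIE h)
  have hdep : M.Dep (insert e I) := by
    rw [hI.indep.insert_dep_iff, hI.closure_eq_closure]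
    exact ⟨he, heI⟩
  have hnot : insert e I ∉ (Equiv.swap p e '' ·) '' {X | (P ＼ {e}).Dep X} := by
    rintro ⟨X, hX, hXI⟩
    have hX' : X = insert p I := by
      have := congrArg (Equiv.swap p e '' ·) hXI
      simp only [Set.image_image, Equiv.swap_apply_self, Set.image_id', Set.image_insert_eq,
        Equiv.swap_apply_right, hswap I heI hpI] at this
      exact this
    subst hX'
    simp only [Set.mem_ofPred_eq, delete_dep_iff] at hX
    refine hX.1.not_indep ((hindep I (Set.subset_sdiff.2
      ⟨hIE, Set.disjoint_singleton_right.2 heI⟩)).2 ⟨hI.indep, fun h ↦ he' ?_⟩)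
    rw [← hI.closure_eq_closure]
    exact h (by simp)
  rw [numDep, numDep, ← Set.ncard_image_of_injective _
    (Set.image_injective.2 (Equiv.swap p e).injective)]
  exact Set.ncard_lt_ncard ⟨hsub, fun h ↦ hnot (h hdep)⟩ M.finite_setOf_dep

end Matroid

namespace MatroidClass

open Matroid

variable {𝓜 𝓜₁ 𝓜₂ : MatroidClass.{u}} {β : Type u} {M N P R : Matroid β}
  {S Y Y' : Set β} {e e' f p : β}

/-- A freest point that is not a coloop is spanned only by sets spanning everything, so it is a
principal extension into the full flat. -/
lemma IsNatural.mem_of_forall_isFreer (h : 𝓜.IsNatural) [M.Finite] (he : e ∈ M.E)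
    (hfree : ∀ f ∈ M.E, M.IsFreer e f) (hdel : 𝓜.Mem (M ＼ {e})) : 𝓜.Mem M := by
  by_cases hcl : e ∈ M.closure (M.E \ {e})
  · refine h.freeExt hdel (isFreeExt_delete (F := M.E \ {e}) he subset_rfl fun X hX ↦ ?_)
    refine ⟨fun heX f hf ↦ ?_, fun hX' ↦ M.closure_subset_closure_of_subset_closure hX' hcl⟩
    by_cases hfX : f ∈ X
    · exact M.mem_closure_of_mem hfX (hX.trans Set.sdiff_subset)
    · refine hfree f hf.1 X (fun x hx ↦ ⟨(hX hx).1, ?_⟩) heX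
      rintro (rfl | rfl)
      · exact (hX hx).2 rfl
      · exact hfX hx
  · exact h.coloop _ _ M e hdel ⟨fun h ↦ h.2 rfl, by simp [he], rfl,
      (isColoop_iff_notMem_closure_compl he).2 hcl⟩

/-- Elements other than `p`, `e`, `e'` can be removed from `R` before `p` is added. Contracting `p`
makes `e` and `e'` parallel, so `P ／ {p}` is a principal extension of a minor of `P ＼ {e}`. -/
lemma isObstruction_of_isFreeExt (h : 𝓜.IsNatural) [R.Finite] (hP : R.IsFreeExt {e, e'} p P)
    (hside : R.IsSide e e' Y Y') (hY : Y ⊆ R.E \ {e, e'}) (hY' : Y' ⊆ R.E \ {e, e'})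
    (hR : ¬ 𝓜.Mem R) (hdel : ∀ f ∈ R.E, 𝓜.Mem (R ＼ {f})) (hcon : ∀ f ∈ R.E, 𝓜.Mem (R ／ {f}))
    (he : 𝓜.Mem (P ＼ {e})) (he' : 𝓜.Mem (P ＼ {e'})) : 𝓜.IsObstruction P e e' p Y Y' := by
  have := hP.finite
  have heR := hside.mem_ground
  have heR' := hside.symm.mem_ground
  have hpR := hP.notMem
  have hYR := hY.trans Set.sdiff_subset
  have hYR' := hY'.trans Set.sdiff_subset
  have hRP : R.E \ {e, e'} ⊆ P.E \ {e, e'} := Set.sdiff_subset_sdiff_left hP.subset_ground'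
  have hpe : p ≠ e := fun h ↦ hpR (h ▸ heR)
  have hpe' : p ≠ e' := fun h ↦ hpR (h ▸ heR')
  have hee' : {e, e'} ⊆ R.E := Set.pair_subset_iff.2 ⟨heR, heR'⟩
  have hsing : {e} ⊆ R.E := Set.singleton_subset_iff.2 heR
  have hsing' : {e'} ⊆ R.E := Set.singleton_subset_iff.2 heR'
  have hp : p ∈ P.closure {e, e'} := (hP.mem_closure_iff hee').2 (R.subset_closure _ hee')
  have hleft : e ∈ P.closure {p, e'} := by
    refine (closure_exchange ⟨hp, fun h ↦ ?_⟩).1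
    exact hside.symm.notMem_closure_singleton
      ((hP.mem_closure_iff hsing').1 h (Set.mem_insert _ _))
  have hright : e' ∈ P.closure {p, e} := by
    rw [Set.pair_comm] at hp
    refine (closure_exchange ⟨hp, fun h ↦ ?_⟩).1
    exact hside.notMem_closure_singleton
      ((hP.mem_closure_iff hsing).1 h (Set.mem_insert_of_mem _ rfl))
  have hpP : p ∈ P.E \ {e, e'} := ⟨hP.mem_ground, by simp [hpe, hpe']⟩
  -- The three elements are one of `Y` outside `Y'`, one of `Y'` outside `Y`, and `p`.
  have hthree : 3 ≤ (P.E \ {e, e'}).encard := by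
    obtain ⟨y, hy, hy'⟩ := Set.not_subset.1 fun h : Y ⊆ Y' ↦
      hside.notMem' (R.closure_subset_closure h hside.mem)
    obtain ⟨z, hz, hz'⟩ := Set.not_subset.1 fun h : Y' ⊆ Y ↦
      hside.notMem (R.closure_subset_closure h hside.mem')
    have hyz : y ≠ z := fun h ↦ hz' (h ▸ hy)
    have hyp : y ≠ p := fun h ↦ hpR (h ▸ hYR hy)
    have hzp : z ≠ p := fun h ↦ hpR (h ▸ hYR' hz)
    rw [← Set.encard_eq_three.2 ⟨y, z, p, hyz, hyp, hzp, rfl⟩]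
    refine Set.encard_le_encard ?_
    rintro x (rfl | rfl | rfl)
    · exact hRP (hY hy)
    · exact hRP (hY' hz)
    · exact hpP
  refine ⟨⟨(hP.mem_closure_iff_of_mem hYR heR).2 hside.mem, fun h ↦ hside.notMem
      ((hP.mem_closure_iff_of_mem hYR heR').1 h), (hP.mem_closure_iff_of_mem hYR' heR').2 hside.mem',
      fun h ↦ hside.notMem' ((hP.mem_closure_iff_of_mem hYR' heR).1 h)⟩,
      hY.trans hRP, hY'.trans hRP, hpP, hp, hleft, hright, hthree,
      fun h' ↦ hR (hP.delete_eq ▸ h.delete h' _), fun f hf hfp ↦ ?_, fun f hf ↦ ?_⟩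
  · have hfR : f ∈ R.E := ((hP.ground_eq ▸ hf : f ∈ insert p R.E)).resolve_left hfp
    by_cases hfe : f = e
    · rwa [hfe]
    by_cases hfe' : f = e'
    · rwa [hfe']
    exact h.freeExt (hdel f hfR) (hP.delete (Ne.symm hfp) (by simp [hfe, hfe']))
  · by_cases hfp : f = p
    · subst hfp
      have hmem : ∀ {x X}, x ≠ f → (x ∈ (P ／ {f}).closure X ↔ x ∈ P.closure (X ∪ {f})) :=
        fun hx ↦ P.mem_closure_contract_iff hx
      refine h.freeExt (M := P ／ {f} ＼ {e}) (F := {e'}) ?_ (isFreeExt_delete ?_ ?_ fun X hX ↦ ?_)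
      · rw [contract_delete_comm _ (by simpa using hpe)]
        exact h.contract he _
      · exact ⟨hP.subset_ground' heR, hpe.symm⟩
      · rintro _ rfl
        exact ⟨⟨hP.subset_ground' heR', hpe'.symm⟩, hside.ne.symm⟩
      · have hXP : X ⊆ P.E := hX.trans (Set.sdiff_subset.trans Set.sdiff_subset)
        have hfX : X ∪ {f} ⊆ P.E := Set.union_subset hXP (by simpa using hP.mem_ground)
        rw [Set.singleton_subset_iff, hmem hpe.symm, hmem hpe'.symm]
        exact ⟨fun hx ↦ P.closure_subset_closure_of_subset_closure (Set.pair_subset_iff.2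
            ⟨P.mem_closure_of_mem (by simp) hfX, hx⟩) hright,
          fun hx ↦ P.closure_subset_closure_of_subset_closure (Set.pair_subset_iff.2
            ⟨P.mem_closure_of_mem (by simp) hfX, hx⟩) hleft⟩
    · have hfR : f ∈ R.E := ((hP.ground_eq ▸ hf.1 : f ∈ insert p R.E)).resolve_left hfp
      have hfe := hf.2
      simp only [Set.mem_insert_iff, Set.mem_singleton_iff, not_or] at hfe
      exact h.freeExt (hcon f hfR) (hP.contract (by simpa using hfR)
        (by simp [hfe]))

lemma exists_map_disjoint [Infinite β] {γ : Type*} (M : Matroid γ) [M.Finite] (hS : S.Finite) :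
    ∃ (φ : γ → β) (hφ : Set.InjOn φ M.E), Disjoint (M.map φ hφ).E S := by
  have := M.ground_finite.countable.to_subtype
  have := hS.infinite_compl.to_subtype
  obtain ⟨i, hi⟩ := exists_injective_nat M.E
  let ψ : M.E → β := fun x ↦ ((Infinite.natEmbedding (Sᶜ : Set β) (i x) : (Sᶜ : Set β)) : β)
  have hψ : Function.Injective ψ :=
    Subtype.val_injective.comp ((Infinite.natEmbedding _).injective.comp hi)
  obtain ⟨b⟩ : Nonempty β := inferInstance
  have hval : ∀ x : M.E, Function.extend Subtype.val ψ (fun _ ↦ b) x = ψ x := fun x ↦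
    Subtype.val_injective.extend_apply _ _ _
  have hinj : Set.InjOn (Function.extend Subtype.val ψ (fun _ ↦ b)) M.E := by
    intro x hx y hy hxy
    rw [hval ⟨x, hx⟩, hval ⟨y, hy⟩] at hxy
    exact congrArg Subtype.val (hψ hxy)
  refine ⟨_, hinj, ?_⟩
  rw [map_ground, Set.disjoint_left]
  rintro _ ⟨x, hx, rfl⟩
  rw [hval ⟨x, hx⟩]
  exact (Infinite.natEmbedding (Sᶜ : Set β) (i ⟨x, hx⟩)).2

/-- A matroid in `𝓜₂` but not in `𝓜₁` that is as small as possible and, among those, has as few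
dependent sets as possible, has a pair of incomparable points. -/
lemma exists_isObstruction [Infinite β] (h₁ : 𝓜₁.IsNatural) (h₂ : 𝓜₂.IsNatural)
    (hlt : 𝓜₁.ProperSubclass 𝓜₂) (hN : 𝓜₁.Mem N) (hS : S.Finite) :
    ∃ (P : Matroid β) (e e' p : β) (Y Y' : Set β),
      𝓜₁.IsObstruction P e e' p Y Y' ∧ 𝓜₂.Mem P ∧ Disjoint P.E S := by
  let cand : Set (Matroid β) := {M | 𝓜₂.Mem M ∧ ¬ 𝓜₁.Mem M ∧ Disjoint M.E S}
  have hne : cand.Nonempty := by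
    obtain ⟨γ, M, hM₂, hM₁⟩ := hlt.2
    have := 𝓜₂.finite_of_mem M hM₂
    obtain ⟨φ, hφ, hd⟩ := exists_map_disjoint (β := β) M hS
    refine ⟨M.map φ hφ, h₂.map hM₂ φ hφ, fun hmem ↦ hM₁ ?_, hd⟩
    exact h₁.isomorphic _ _ _ _ hmem (M.isomorphic_map φ hφ).symm
  obtain ⟨R, ⟨hR₂, hR₁, hd⟩, hmin⟩ := (InvImage.wf
    (fun M : Matroid β ↦ toLex (M.E.ncard, M.numDep)) wellFounded_lt).has_min cand hne
  have hRfin := 𝓜₂.finite_of_mem R hR₂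
  have hsmall : ∀ M, 𝓜₂.Mem M → M.E ⊂ R.E → 𝓜₁.Mem M := by
    intro M hM hss
    by_contra hcon
    refine hmin M ⟨hM, hcon, hd.mono_left hss.subset⟩ (Prod.Lex.toLex_lt_toLex.2 (Or.inl ?_))
    exact Set.ncard_lt_ncard hss hRfin.ground_finite
  have hss : ∀ f ∈ R.E, R.E \ {f} ⊂ R.E := fun f hf ↦ Set.sdiff_singleton_ssubset.2 hf
  have hdel : ∀ f ∈ R.E, 𝓜₁.Mem (R ＼ {f}) := fun f hf ↦ hsmall _ (h₂.delete hR₂ _) (hss f hf)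
  have hcon : ∀ f ∈ R.E, 𝓜₁.Mem (R ／ {f}) := fun f hf ↦ hsmall _ (h₂.contract hR₂ _) (hss f hf)
  -- The empty matroid is in `𝓜₁`, as a minor of `N`.
  have hRne : R.E.Nonempty := by
    rw [Set.nonempty_iff_ne_empty]
    intro h0
    refine hR₁ ?_
    rw [ground_eq_empty_iff.1 h0, ← ground_eq_empty_iff.1 (show (N ＼ N.E).E = ∅ by simp)]
    exact h₁.delete hN _
  obtain ⟨e, he, e', he', hee', hee''⟩ : ∃ e ∈ R.E, ∃ e' ∈ R.E,
      ¬ R.IsFreer e e' ∧ ¬ R.IsFreer e' e := by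
    by_contra! hall
    obtain ⟨e, he, hfree⟩ := R.exists_forall_isFreer hRne fun e he f hf ↦
      or_iff_not_imp_left.2 (hall e he f hf)
    exact hR₁ (h₁.mem_of_forall_isFreer he hfree (hdel e he))
  simp only [IsFreer, not_forall] at hee' hee''
  obtain ⟨Y, hY, hYe, hYe'⟩ := hee'
  obtain ⟨Y', hY', hYe₂, hYe₂'⟩ := hee''
  rw [Set.pair_comm] at hY'
  obtain ⟨p, hp⟩ := (R.ground_finite.union hS).exists_notMem
  rw [Set.mem_union, not_or] at hp
  have hP := R.isFreeExt_freeExt (Set.pair_subset_iff.2 ⟨he, he'⟩) hp.1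
  set P := R.freeExt {e, e'} p
  have hP₂ := h₂.freeExt hR₂ hP
  have hPd : Disjoint P.E S := by
    rw [hP.ground_eq, Set.disjoint_insert_left]
    exact ⟨hp.2, hd⟩
  -- `P ＼ {x}` has as many elements as `R`, so the number of dependent sets decides.
  have hmove : ∀ x ∈ R.E, (P ＼ {x}).numDep < R.numDep → 𝓜₁.Mem (P ＼ {x}) := by
    intro x hx hlt
    by_contra hcon
    refine hmin (P ＼ {x}) ⟨h₂.delete hP₂ _, hcon, hPd.mono_left Set.sdiff_subset⟩
      (Prod.Lex.toLex_lt_toLex.2 (Or.inr ⟨?_, hlt⟩))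
    have h1 := Set.ncard_sdiff_singleton_of_mem (hP.subset_ground' hx)
    have h2 := Set.ncard_insert_of_notMem hp.1 R.ground_finite
    rw [← hP.ground_eq] at h2
    change (P.E \ {x}).ncard = R.E.ncard
    omega
  refine ⟨P, e, e', p, Y, Y', isObstruction_of_isFreeExt h₁ hP ⟨hYe, hYe', hYe₂, hYe₂'⟩ hY hY' hR₁ hdel
    hcon (hmove e he (hP.numDep_delete_lt hY hYe hYe')) (hmove e' he' ?_), hP₂, hPd⟩
  rw [Set.pair_comm] at hP hY'
  exact hP.numDep_delete_lt hY' hYe₂ hYe₂'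

end MatroidClass

/-! ### Hyperplane pairs, moving a point onto a line, adding coloops -/

namespace Matroid

variable {α : Type*} {M N P G : Matroid α} {A B X Y : Set α} {a b c f g g' x z z₁ z₂ : α}

/-- `A` and `B` are complementary hyperplanes of `M`, both independent. -/
structure IsHyperplanePair (M : Matroid α) (A B : Set α) : Prop where
  union_eq : A ∪ B = M.E
  disjoint : Disjoint A B
  indep : M.Indep A
  indep' : M.Indep B
  rankOf_eq : M.rankOf M.E = A.ncard + 1
  rankOf_eq' : M.rankOf M.E = B.ncard + 1

namespace IsHyperplanePair

lemma symm (h : M.IsHyperplanePair A B) : M.IsHyperplanePair B A :=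
  ⟨by rw [Set.union_comm, h.union_eq], h.disjoint.symm, h.indep', h.indep, h.rankOf_eq',
    h.rankOf_eq⟩

lemma closure_eq_ground [M.Finite] (h : M.IsHyperplanePair A B) (hA : M.closure A = A)
    (hX : X ⊆ M.E) (hAX : A ⊆ M.closure X) (hXA : ¬ X ⊆ A) : M.closure X = M.E := by
  obtain ⟨x, hxX, hxA⟩ := Set.not_subset.1 hXA
  have h1 : M.rankOf (insert x A) = M.rankOf A + 1 :=
    M.rankOf_insert_of_notMem_closure (hX hxX) (hA.symm ▸ hxA)
  have h2 := M.rankOf_mono (Set.insert_subset (M.mem_closure_of_mem hxX hX) hAX)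
  rw [rankOf_closure, h1, h.indep.rankOf_eq_ncard, ← h.rankOf_eq] at h2
  rw [M.closure_eq_closure_of_rankOf_le hX h2, closure_ground]

/-- As `A` is independent, no part of it missing `f` spans it; so `X` leaves the hyperplane `A`. -/
lemma closure_eq_ground_of_notMem [M.Finite] (h : M.IsHyperplanePair A B) (hA : M.closure A = A)
    (hf : f ∈ A) (hX : X ⊆ M.E) (hfX : f ∉ X) (hAX : A ⊆ M.closure X) : M.closure X = M.E := by
  refine h.closure_eq_ground hA hX hAX fun hXA ↦ ?_
  have h1 := M.rankOf_mono hAX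
  have hfin := M.ground_finite.subset hX
  have hlt : X.ncard < A.ncard := Set.ncard_lt_ncard ⟨hXA, fun h' ↦ hfX (h' hf)⟩
    (M.ground_finite.subset h.indep.subset_ground)
  have h2 := M.rankOf_le_ncard hfin
  rw [rankOf_closure, h.indep.rankOf_eq_ncard] at h1
  omega

/-- Placing a free point on each of two complementary independent hyperplanes that are flats gives
a gadget. -/
lemma isGadget [M.Finite] (h : M.IsHyperplanePair A B) (hA : M.closure A = A)
    (hB : M.closure B = B) (hA2 : 2 ≤ A.ncard) (hP : M.IsFreeExt A g P) (hG : P.IsFreeExt B g' G) :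
    G.IsGadget g g' A B := by
  have := hP.finite
  have := hG.finite
  have hAE := h.indep.subset_ground
  have hBE := h.indep'.subset_ground
  have hMP := hP.subset_ground'
  have hB2 : 2 ≤ B.ncard := by have := h.rankOf_eq; have := h.rankOf_eq'; omega
  have hAne : A.Nonempty := Set.nonempty_of_ncard_ne_zero (by omega)
  have hBne : B.Nonempty := Set.nonempty_of_ncard_ne_zero (by omega)
  have hgP := hP.mem_ground
  have hg : ∀ X ⊆ M.E, (g ∈ G.closure X ↔ A ⊆ M.closure X) := fun X hX ↦ by
    rw [hG.mem_closure_iff_of_mem (hX.trans hMP) hgP, hP.mem_closure_iff hX]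
  have hg' : ∀ X ⊆ M.E, (g' ∈ G.closure X ↔ B ⊆ M.closure X) := fun X hX ↦ by
    rw [hG.mem_closure_iff (hX.trans hMP)]
    exact forall₂_congr fun x hx ↦ hP.mem_closure_iff_of_mem hX (hBE hx)
  have hGE : M.E = G.E \ {g, g'} := by
    have h1 := hP.notMem
    have h2 : g' ∉ M.E := fun h ↦ hG.notMem (hMP h)
    rw [hG.ground_eq, hP.ground_eq]
    ext x
    simp only [Set.mem_sdiff, Set.mem_insert_iff, Set.mem_singleton_iff]
    constructor
    · intro hx
      exact ⟨Or.inr (Or.inr hx), by rintro (rfl | rfl) <;> contradiction⟩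
    · tauto
  have hgM := hP.notMem
  have hg'M : g' ∉ M.E := fun h ↦ hG.notMem (hMP h)
  have hgf : ∀ {f}, f ∈ M.E → g ∉ ({f} : Set α) := fun hf h ↦ hgM (h ▸ hf)
  have hgf' : ∀ {f}, f ∈ M.E → g' ∉ ({f} : Set α) := fun hf h ↦ hg'M (h ▸ hf)
  have hdelE : ∀ {f X}, X ⊆ (G ＼ {f}).E \ {g, g'} → X ⊆ M.E ∧ f ∉ X := by
    intro f X hX
    exact ⟨fun x hx ↦ hGE ▸ ⟨(hX hx).1.1, (hX hx).2⟩, fun hf ↦ (hX hf).1.2 rfl⟩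
  have hconE : ∀ {f X}, X ⊆ (G ／ {f}).E \ {g, g'} → X ⊆ M.E := fun hX ↦ (hdelE hX).1
  refine ⟨⟨(hg A hAE).2 (M.subset_closure A), fun h' ↦ ?_, (hg' B hBE).2 (M.subset_closure B),
    fun h' ↦ ?_⟩, h.union_eq.trans hGE, ?_, ?_, ?_⟩
  · have h1 := hA ▸ (hg' A hAE).1 h'
    obtain ⟨x, hx⟩ := hBne
    exact h.disjoint.notMem_of_mem_left (h1 hx) hx
  · have h1 := hB ▸ (hg B hBE).1 h'
    obtain ⟨x, hx⟩ := hAne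
    exact h.disjoint.notMem_of_mem_left hx (h1 hx)
  · have hfin := M.ground_finite
    rw [← h.union_eq] at hfin
    rw [← hfin.cast_ncard_eq, Set.ncard_union_eq h.disjoint (hfin.subset Set.subset_union_left)
      (hfin.subset Set.subset_union_right)]
    exact_mod_cast (show 3 ≤ A.ncard + B.ncard by omega)
  -- After deleting `f ∈ A`, every set spanning `g` spans everything, so `g` is freer.
  · rintro f (hf | hf)
    · refine Or.inl fun X hX hgX ↦ ?_
      obtain ⟨hXM, hfX⟩ := hdelE hX
      have hd : Disjoint X {f} := Set.disjoint_singleton_right.2 hfX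
      rw [mem_closure_delete_iff _ hd (hgf (hAE hf)), hg X hXM] at hgX
      rw [mem_closure_delete_iff _ hd (hgf' (hAE hf)), hg' X hXM,
        h.closure_eq_ground_of_notMem hA hf hXM hfX hgX]
      exact hBE
    · refine Or.inr fun X hX hgX ↦ ?_
      rw [Set.pair_comm] at hX
      obtain ⟨hXM, hfX⟩ := hdelE hX
      have hd : Disjoint X {f} := Set.disjoint_singleton_right.2 hfX
      rw [mem_closure_delete_iff _ hd (hgf' (hBE hf)), hg' X hXM] at hgX
      rw [mem_closure_delete_iff _ hd (hgf (hBE hf)), hg X hXM,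
        h.symm.closure_eq_ground_of_notMem hB hf hXM hfX hgX]
      exact hAE
  -- Contracting `f ∈ A` works the other way: a set with `f` that spans `B` is not inside `B`, hence
  -- spans everything, so `g'` is freer.
  · rintro f (hf | hf)
    · refine Or.inr fun X hX hgX ↦ ?_
      rw [Set.pair_comm] at hX
      have hXf : X ∪ {f} ⊆ M.E := Set.union_subset (hconE hX) (by simpa using hAE hf)
      rw [mem_closure_contract_iff _ (hgf' (hAE hf)), hg' _ hXf] at hgX
      rw [mem_closure_contract_iff _ (hgf (hAE hf)), hg _ hXf,
        h.symm.closure_eq_ground hB hXf hgX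
          fun h' ↦ h.disjoint.notMem_of_mem_left hf (h' (by simp))]
      exact hAE
    · refine Or.inl fun X hX hgX ↦ ?_
      have hXf : X ∪ {f} ⊆ M.E := Set.union_subset (hconE hX) (by simpa using hBE hf)
      rw [mem_closure_contract_iff _ (hgf (hBE hf)), hg _ hXf] at hgX
      rw [mem_closure_contract_iff _ (hgf' (hBE hf)), hg' _ hXf,
        h.closure_eq_ground hA hXf hgX
          fun h' ↦ h.disjoint.notMem_of_mem_right hf (h' (by simp))]
      exact hBE

end IsHyperplanePair

/-- `N` is obtained from `M` by moving `b` freely onto the line through `b` and `z`. -/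
structure IsMove (M : Matroid α) (b z : α) (N : Matroid α) : Prop where
  mem : b ∈ M.E
  mem' : z ∈ M.E
  ne : b ≠ z
  ground_eq : N.E = M.E
  rankOf_eq : ∀ X ⊆ M.E, b ∉ X → N.rankOf X = M.rankOf X
  rankOf_insert : ∀ X ⊆ M.E, b ∉ X →
    N.rankOf (insert b X) + boolNat ({b, z} ⊆ M.closure X) = M.rankOf X + 1

namespace IsMove

lemma finite [hM : M.Finite] (h : M.IsMove b z N) : N.Finite := ⟨h.ground_eq ▸ hM.ground_finite⟩

lemma mem_closure_iff [M.Finite] (h : M.IsMove b z N) (hX : X ⊆ M.E) (hb : b ∉ X) :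
    b ∈ N.closure X ↔ {b, z} ⊆ M.closure X := by
  have := h.finite
  rw [mem_closure_iff_rankOf _ (h.ground_eq ▸ h.mem), h.rankOf_eq X hX hb]
  have := h.rankOf_insert X hX hb
  by_cases hbz : {b, z} ⊆ M.closure X
  · rw [boolNat_true hbz] at this
    simp only [hbz, iff_true]; omega
  · rw [boolNat_false hbz] at this
    simp only [hbz, iff_false]; omega

lemma mem_closure_iff_of_ne [M.Finite] (h : M.IsMove b z N) (hX : X ⊆ M.E) (hb : b ∉ X)
    (hx : x ∈ M.E) (hxb : x ≠ b) : x ∈ N.closure X ↔ x ∈ M.closure X := by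
  have := h.finite
  rw [mem_closure_iff_rankOf _ (h.ground_eq ▸ hx), mem_closure_iff_rankOf _ hx,
    h.rankOf_eq X hX hb, h.rankOf_eq _ (Set.insert_subset hx hX) (by simp [hb, hxb.symm])]

/-- A set containing `z` spans `b` if and only if it spans `{b, z}`, so contracting `z` undoes the
move. This is how the original matroid survives as a minor. -/
lemma contract_eq [M.Finite] (h : M.IsMove b z N) : N ／ {z} = M ／ {z} := by
  have := h.finite
  refine ext_rankOf (by simp [h.ground_eq]) fun X hX ↦ ?_
  have hz : {z} ⊆ M.E := Set.singleton_subset_iff.2 h.mem'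
  have hXM : X ⊆ M.E := h.ground_eq ▸ hX.trans Set.sdiff_subset
  rw [rankOf_contract, rankOf_contract, h.rankOf_eq {z} hz h.ne]
  congr 1
  by_cases hb : b ∈ X
  · obtain ⟨Y, hbY, rfl⟩ : ∃ Y, b ∉ Y ∧ X = insert b Y := ⟨X \ {b}, by simp, by simp [hb]⟩
    have hYz : Y ∪ {z} ⊆ M.E := Set.union_subset ((Set.subset_insert _ _).trans hXM) hz
    have hbYz : b ∉ Y ∪ {z} := by simp [hbY, h.ne]
    rw [Set.insert_union]
    have h1 := h.rankOf_insert _ hYz hbYz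
    have hiff : {b, z} ⊆ M.closure (Y ∪ {z}) ↔ b ∈ M.closure (Y ∪ {z}) := by
      rw [Set.pair_subset_iff]
      exact and_iff_left (M.mem_closure_of_mem (by simp) hYz)
    rw [boolNat_congr hiff] at h1
    by_cases hcl : b ∈ M.closure (Y ∪ {z})
    · rw [boolNat_true hcl] at h1
      rw [M.rankOf_insert_of_mem_closure hcl]
      omega
    · rw [boolNat_false hcl] at h1
      rw [M.rankOf_insert_of_notMem_closure h.mem hcl]
      omega
  · exact h.rankOf_eq _ (Set.union_subset hXM hz) (by simp [hb, h.ne])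

end IsMove

lemma IsFreeExt.exists_isMove [M.Finite] (hP : M.IsFreeExt {b, z} x P) (hbz : b ≠ z) :
    ∃ (φ : α → α) (hφ : Set.InjOn φ (P ＼ {b}).E), M.IsMove b z ((P ＼ {b}).map φ hφ) := by
  classical
  obtain ⟨hb, hz⟩ := Set.pair_subset_iff.1 hP.subset_ground
  have hxb : x ≠ b := fun h ↦ hP.notMem (h ▸ hb)
  have hrk : ∀ X, ((P ＼ {b}).map (Equiv.swap x b) (Equiv.swap x b).injective.injOn).rankOf X =
      (P ＼ {b}).rankOf (Equiv.swap x b '' X) := by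
    intro X
    have h1 : Equiv.swap x b '' (Equiv.swap x b '' X) = X := by
      simp [Set.image_image]
    conv_lhs => rw [← h1]
    by_cases hX : Equiv.swap x b '' X ⊆ (P ＼ {b}).E
    · rw [rankOf, rankOf, eRk_map _ _ hX]
    · rw [← rankOf_inter_ground, map_ground, ← Set.image_inter (Equiv.swap x b).injective,
        ← (P ＼ {b}).rankOf_inter_ground, rankOf, rankOf, eRk_map _ _ Set.inter_subset_right]
  have hxX : ∀ {X}, X ⊆ M.E → x ∉ X := fun hX h ↦ hP.notMem (hX h)
  refine ⟨Equiv.swap x b, (Equiv.swap x b).injective.injOn, hb, hz, hbz, ?_, fun X hX hbX ↦ ?_,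
    fun X hX hbX ↦ ?_⟩
  · rw [map_ground, delete_ground, hP.ground_eq, Set.insert_sdiff_of_notMem _ (by simpa using hxb),
      Set.image_insert_eq, Equiv.swap_apply_left,
      image_swap_of_notMem (fun h ↦ hP.notMem h.1) (fun h ↦ h.2 rfl)]
    simp [hb]
  · rw [hrk, image_swap_of_notMem (hxX hX) hbX,
      rankOf_delete _ (Set.disjoint_singleton_right.2 hbX), hP.rankOf_eq X hX]
  · rw [hrk, Set.image_insert_eq, Equiv.swap_apply_right, image_swap_of_notMem (hxX hX) hbX,
      rankOf_delete _ (Set.disjoint_singleton_right.2 (by simp [hbX, hxb.symm])),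
      hP.rankOf_insert X hX]

/-- `N` is obtained from `M` by adding the coloop `c`. -/
structure IsAddColoop (M : Matroid α) (c : α) (N : Matroid α) : Prop where
  notMem : c ∉ M.E
  ground_eq : N.E = insert c M.E
  rankOf_eq : ∀ X ⊆ M.E, N.rankOf X = M.rankOf X
  rankOf_insert : ∀ X ⊆ M.E, N.rankOf (insert c X) = M.rankOf X + 1

lemma exists_isAddColoop [M.Finite] (hc : c ∉ M.E) : ∃ N, M.IsAddColoop c N := by
  have hfin : (freeOn {c}).Finite := ⟨Set.finite_singleton c⟩
  have hS := isSum_disjointSum (M := M) (N := freeOn {c}) (by simpa using hc)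
  have hr : (freeOn {c}).rankOf {c} = 1 := by
    simp [rankOf, eRk_freeOn]
  refine ⟨_, hc, by rw [hS.ground_eq, freeOn_ground, Set.union_singleton], fun X hX ↦ ?_,
    fun X hX ↦ ?_⟩
  · have := hS.rankOf_union X hX ∅ (Set.empty_subset _)
    rwa [Set.union_empty, rankOf_empty] at this
  · have := hS.rankOf_union X hX {c} (by simp)
    rwa [Set.union_singleton, hr] at this

namespace IsAddColoop

lemma finite [hM : M.Finite] (h : M.IsAddColoop c N) : N.Finite :=
  ⟨h.ground_eq ▸ hM.ground_finite.insert c⟩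

lemma subset_ground (h : M.IsAddColoop c N) : M.E ⊆ N.E := h.ground_eq ▸ Set.subset_insert _ _

lemma mem_ground (h : M.IsAddColoop c N) : c ∈ N.E := h.ground_eq ▸ Set.mem_insert _ _

lemma delete_eq [M.Finite] (h : M.IsAddColoop c N) : N ＼ {c} = M := by
  have := h.finite
  have hE : (N ＼ {c}).E = M.E := by simp [h.ground_eq, h.notMem]
  refine ext_rankOf hE fun X hX ↦ ?_
  rw [rankOf_delete, h.rankOf_eq X (hE ▸ hX)]
  exact Set.disjoint_singleton_right.2 fun hcX ↦ (hX hcX).2 rfl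

lemma contract_eq [M.Finite] (h : M.IsAddColoop c N) : N ／ {c} = M := by
  have := h.finite
  have hE : (N ／ {c}).E = M.E := by simp [h.ground_eq, h.notMem]
  refine ext_rankOf hE fun X hX ↦ ?_
  have h1 := h.rankOf_insert ∅ (Set.empty_subset _)
  rw [insert_empty_eq, rankOf_empty] at h1
  rw [rankOf_contract, Set.union_singleton, h.rankOf_insert X (hE ▸ hX), h1]
  omega

lemma notMem_closure [M.Finite] (h : M.IsAddColoop c N) (hX : X ⊆ M.E) : c ∉ N.closure X := by
  have := h.finite
  rw [mem_closure_iff_rankOf _ h.mem_ground, h.rankOf_insert X hX, h.rankOf_eq X hX]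
  omega

lemma isColoopExtension [M.Finite] (h : M.IsAddColoop c N) : M.IsColoopExtension c N := by
  refine ⟨h.notMem, h.ground_eq, h.delete_eq,
    (isColoop_iff_notMem_closure_compl h.mem_ground).2 (h.notMem_closure ?_)⟩
  simp [h.ground_eq, h.notMem]

lemma indep (h : M.IsAddColoop c N) [M.Finite] (hX : M.Indep X) : N.Indep X := by
  rw [← h.delete_eq, delete_indep_iff] at hX
  exact hX.1

lemma indep_insert (h : M.IsAddColoop c N) [M.Finite] (hX : M.Indep X) :
    N.Indep (insert c X) := by
  have hc : c ∉ X := fun h' ↦ h.notMem (hX.subset_ground h')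
  exact ((h.indep hX).insert_indep_iff_of_notMem hc).2
    ⟨h.mem_ground, h.notMem_closure hX.subset_ground⟩

end IsAddColoop

end Matroid

namespace MatroidClass

open Matroid

variable {𝓜 : MatroidClass.{u}} {β : Type u} {M N : Matroid β} {b c z : β}

lemma IsNatural.addColoop (h : 𝓜.IsNatural) (hM : 𝓜.Mem M) (hN : M.IsAddColoop c N) :
    𝓜.Mem N := by
  have := 𝓜.finite_of_mem _ hM
  exact h.coloop _ _ _ _ hM hN.isColoopExtension

lemma IsNatural.exists_isMove [Infinite β] (h : 𝓜.IsNatural) (hM : 𝓜.Mem M) (hb : b ∈ M.E)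
    (hz : z ∈ M.E) (hbz : b ≠ z) : ∃ N, M.IsMove b z N ∧ 𝓜.Mem N := by
  have := 𝓜.finite_of_mem _ hM
  obtain ⟨x, hx⟩ := M.ground_finite.exists_notMem
  have hP := M.isFreeExt_freeExt (Set.pair_subset_iff.2 ⟨hb, hz⟩) hx
  obtain ⟨φ, hφ, hN⟩ := hP.exists_isMove hbz
  exact ⟨_, hN, h.map (h.delete (h.freeExt hM hP) _) φ hφ⟩

end MatroidClass

/-! ### Embedding a member of a natural class in a gadget -/

namespace Matroid

variable {α : Type*} {M N P G : Matroid α} {A B X Y : Set α} {a b c f g g' p x z z₁ z₂ : α}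

lemma IsMove.indep [M.Finite] (h : M.IsMove b z N) (hX : M.Indep X) (hb : b ∉ X) : N.Indep X := by
  have := h.finite
  rw [indep_iff_rankOf (M.ground_finite.subset hX.subset_ground),
    h.rankOf_eq X hX.subset_ground hb, hX.rankOf_eq_ncard]

lemma IsMove.indep_of_mem [M.Finite] (h : M.IsMove b z N) (hX : M.Indep X) (hb : b ∈ X) :
    N.Indep X := by
  have := h.finite
  have hXb := hX.subset (Set.sdiff_subset (t := {b}))
  rw [← Set.insert_sdiff_self_of_mem hb, (h.indep hXb (by simp)).insert_indep_iff_of_notMem (by simp)]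
  refine ⟨h.ground_eq ▸ h.mem, fun h' ↦ hX.notMem_closure_sdiff_of_mem hb ?_⟩
  exact (h.mem_closure_iff hXb.subset_ground (by simp)).1 h' (Set.mem_insert _ _)

lemma IsFreeExt.indep [M.Finite] (h : M.IsFreeExt X p P) (hA : M.Indep A) : P.Indep A := by
  rw [← h.delete_eq, delete_indep_iff] at hA
  exact hA.1

/-- Independent sets stay independent, and the rank does not rise because the other elements still
span both `b` and `z`. -/
lemma IsMove.isHyperplanePair [M.Finite] (hN : M.IsMove b z N) (h : M.IsHyperplanePair A B)
    (hb : b ∈ B) (hbA : b ∈ M.closure A) : N.IsHyperplanePair A B := by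
  have := hN.finite
  have hbA' : b ∉ A := h.disjoint.notMem_of_mem_right hb
  have hsub : M.E \ {b} ⊆ M.E := Set.sdiff_subset
  have hbE : b ∉ M.E \ {b} := fun h ↦ h.2 rfl
  have hcl : {b, z} ⊆ M.closure (M.E \ {b}) := by
    refine Set.pair_subset_iff.2 ⟨M.closure_subset_closure ?_ hbA,
      M.mem_closure_of_mem ⟨hN.mem', hN.ne.symm⟩ hsub⟩
    exact fun x hx ↦ ⟨h.indep.subset_ground hx, fun hxb ↦ hbA' (hxb ▸ hx)⟩
  have hr : N.rankOf N.E = M.rankOf M.E := by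
    have h1 := hN.rankOf_insert _ hsub hbE
    rw [boolNat_true hcl, Set.insert_sdiff_self_of_mem hN.mem] at h1
    have h2 := M.rankOf_insert_of_mem_closure (hcl (Set.mem_insert _ _))
    rw [Set.insert_sdiff_self_of_mem hN.mem] at h2
    rw [hN.ground_eq]
    omega
  exact ⟨h.union_eq.trans hN.ground_eq.symm, h.disjoint, hN.indep h.indep hbA',
    hN.indep_of_mem h.indep' hb, hr.trans h.rankOf_eq, hr.trans h.rankOf_eq'⟩

/-- Since independent sets stay independent, repairing one hyperplane does not spoil the other. -/
lemma IsMove.mem_closure_of_mem_closure [M.Finite] (hN : M.IsMove b z N)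
    (h : M.IsHyperplanePair A B) (hb : b ∈ B) (hx : x ∈ A) (hxB : x ∈ N.closure B) :
    x ∈ M.closure B := by
  have := hN.finite
  by_contra hcon
  have hxB' : x ∉ B := h.disjoint.notMem_of_mem_left hx
  have hxE := h.indep.subset_ground hx
  have hi : M.Indep (insert x B) := (h.indep'.insert_indep_iff_of_notMem hxB').2 ⟨hxE, hcon⟩
  have hi' := hN.indep_of_mem hi (Set.mem_insert_of_mem _ hb)
  rw [(hN.indep_of_mem h.indep' hb).insert_indep_iff_of_notMem hxB'] at hi'
  exact hi'.2 hxB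

end Matroid

namespace MatroidClass

open Matroid

variable {𝓜 : MatroidClass.{u}} {β : Type u} [Infinite β] {M N : Matroid β} {A B : Set β}
  {z₁ z₂ : β}

/-- Move a point `b ∈ B` in the closure of `A` onto the line through `b` and `z₂`. As `z₂` is
outside that closure, `b` leaves it, and the number of misplaced points drops. -/
lemma IsNatural.exists_flats (h : 𝓜.IsNatural) (hM : 𝓜.Mem M) (hAB : M.IsHyperplanePair A B)
    (hz₁ : z₁ ∈ A) (hz₂ : z₂ ∈ B) (hz₁' : z₁ ∉ M.closure B) (hz₂' : z₂ ∉ M.closure A) :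
    ∃ N, 𝓜.Mem N ∧ N.IsHyperplanePair A B ∧ N.closure A = A ∧ N.closure B = B ∧
      N ／ {z₁, z₂} = M ／ {z₁, z₂} := by
  induction hn : (M.closure A ∩ B).ncard + (M.closure B ∩ A).ncard using Nat.strong_induction_on
    generalizing M A B z₁ z₂ with
  | _ n ih =>
  have hMfin := 𝓜.finite_of_mem _ hM
  have hfin : ∀ {X Y}, (M.closure X ∩ Y).Finite :=
    (M.ground_finite.subset (M.closure_subset_ground _)).inter_of_left _
  have key : ∀ {A B : Set β} {z₁ z₂ : β}, M.IsHyperplanePair A B → z₁ ∈ A → z₂ ∈ B →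
      z₁ ∉ M.closure B → z₂ ∉ M.closure A →
      (M.closure A ∩ B).ncard + (M.closure B ∩ A).ncard = n → (M.closure A ∩ B).Nonempty →
      ∃ N, 𝓜.Mem N ∧ N.IsHyperplanePair A B ∧ N.closure A = A ∧ N.closure B = B ∧
        N ／ {z₁, z₂} = M ／ {z₁, z₂} := by
    rintro A B z₁ z₂ hAB hz₁ hz₂ hz₁' hz₂' hn ⟨b, hbA, hb⟩
    have hAE := hAB.indep.subset_ground
    have hBE := hAB.indep'.subset_ground
    have hbz : b ≠ z₂ := fun h ↦ hz₂' (h ▸ hbA)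
    have hbA' : b ∉ A := hAB.disjoint.notMem_of_mem_right hb
    obtain ⟨N, hN, hNmem⟩ := h.exists_isMove hM (hBE hb) (hBE hz₂) hbz
    have hNA : ∀ {x}, x ∈ B → x ∈ N.closure A → x ∈ M.closure A ∧ x ≠ b := by
      intro x hx hxA
      have hxb : x ≠ b := by
        rintro rfl
        exact hz₂' ((hN.mem_closure_iff hAE hbA').1 hxA (by simp))
      exact ⟨(hN.mem_closure_iff_of_ne hAE hbA' (hBE hx) hxb).1 hxA, hxb⟩
    have hNB : ∀ {x}, x ∈ A → x ∈ N.closure B → x ∈ M.closure B :=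
      fun hx ↦ hN.mem_closure_of_mem_closure hAB hb hx
    have h1 : (N.closure A ∩ B).ncard < (M.closure A ∩ B).ncard := by
      refine Set.ncard_lt_ncard ⟨fun x hx ↦ ⟨(hNA hx.2 hx.1).1, hx.2⟩, fun h' ↦ ?_⟩ hfin
      exact (hNA hb (h' ⟨hbA, hb⟩).1).2 rfl
    have h2 : (N.closure B ∩ A).ncard ≤ (M.closure B ∩ A).ncard :=
      Set.ncard_le_ncard (fun x hx ↦ ⟨hNB hx.2 hx.1, hx.2⟩) hfin
    obtain ⟨N', hN', hN'AB, hA, hB, hc⟩ := ih _ (by omega) hNmem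
      (hN.isHyperplanePair hAB hb hbA) hz₁ hz₂ (fun h' ↦ hz₁' (hNB hz₁ h'))
      (fun h' ↦ hz₂' (hNA hz₂ h').1) rfl
    refine ⟨N', hN', hN'AB, hA, hB, hc.trans ?_⟩
    rw [Set.pair_comm, ← Set.singleton_union, ← contract_contract, ← contract_contract,
      hN.contract_eq]
  by_cases hA : (M.closure A ∩ B).Nonempty
  · exact key hAB hz₁ hz₂ hz₁' hz₂' hn hA
  by_cases hB : (M.closure B ∩ A).Nonempty
  · obtain ⟨N, hN, hN', hB, hA, hc⟩ := key hAB.symm hz₂ hz₁ hz₂' hz₁' (by omega) hB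
    exact ⟨N, hN, hN'.symm, hA, hB, by rwa [Set.pair_comm]⟩
  rw [Set.not_nonempty_iff_eq_empty] at hA hB
  refine ⟨M, hM, hAB, ?_, ?_, rfl⟩
  · refine subset_antisymm (fun x hx ↦ ?_) (M.subset_closure A hAB.indep.subset_ground)
    have hxE := hAB.union_eq.symm ▸ mem_ground_of_mem_closure hx
    exact hxE.resolve_right fun hxB ↦ (hA ▸ ⟨hx, hxB⟩ : x ∈ (∅ : Set β))
  · refine subset_antisymm (fun x hx ↦ ?_) (M.subset_closure B hAB.indep'.subset_ground)
    have hxE := hAB.union_eq.symm ▸ mem_ground_of_mem_closure hx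
    exact hxE.resolve_left fun hxA ↦ (hB ▸ ⟨hx, hxA⟩ : x ∈ (∅ : Set β))

/-- While some `a ∈ A` is spanned by the rest of `A`, add a coloop `c` to `B` and move `a` onto the
line through `a` and `c`. The rank of `A` goes up by one, and contracting `c` restores the matroid.
-/
lemma IsNatural.exists_indep_partition (h : 𝓜.IsNatural) (hM : 𝓜.Mem M) (hE : A ∪ B = M.E)
    (hd : Disjoint A B) (hB : M.Indep B) :
    ∃ (N : Matroid β) (B' : Set β), 𝓜.Mem N ∧ M ≤m N ∧ A ∪ B' = N.E ∧ Disjoint A B' ∧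
      N.Indep A ∧ N.Indep B' ∧ B ⊆ B' := by
  induction hn : A.ncard - M.rankOf A using Nat.strong_induction_on generalizing M B with
  | _ n ih =>
  have hMfin := 𝓜.finite_of_mem _ hM
  have hAE : A ⊆ M.E := hE ▸ Set.subset_union_left
  by_cases hA : M.Indep A
  · exact ⟨M, B, hM, IsMinor.refl, hE, hd, hA, hB, subset_rfl⟩
  have hAfin := M.ground_finite.subset hAE
  have hlt : M.rankOf A < A.ncard :=
    (M.rankOf_le_ncard hAfin).lt_of_ne fun h' ↦ hA ((indep_iff_rankOf hAfin).2 h')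
  obtain ⟨a, ha, haA⟩ : ∃ a ∈ A, a ∈ M.closure (A \ {a}) := by
    by_contra! hcon
    exact hA ((indep_iff_forall_notMem_closure_sdiff hAE).2 fun a ha ↦ hcon a ha)
  obtain ⟨c, hc⟩ := M.ground_finite.exists_notMem
  obtain ⟨M₁, hM₁⟩ := exists_isAddColoop hc
  have hM₁fin := hM₁.finite
  have hac : a ≠ c := fun h' ↦ hc (h' ▸ hAE ha)
  have haB : a ∉ insert c B := by simp [hac, hd.notMem_of_mem_left ha]
  have hAa : A \ {a} ⊆ M.E := Set.sdiff_subset.trans hAE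
  obtain ⟨M₂, hM₂, hM₂mem⟩ := h.exists_isMove (h.addColoop hM hM₁) (hM₁.subset_ground (hAE ha))
    hM₁.mem_ground hac
  have hM₂A : M₂.rankOf A = M.rankOf A + 1 := by
    have h1 := hM₂.rankOf_insert _ (hAa.trans hM₁.subset_ground) (fun h ↦ h.2 rfl)
    rw [Set.insert_sdiff_self_of_mem ha, boolNat_false fun h' ↦ hM₁.notMem_closure hAa
      (h' (by simp)), hM₁.rankOf_eq _ hAa] at h1
    have h2 := M.rankOf_insert_of_mem_closure haA
    rw [Set.insert_sdiff_self_of_mem ha] at h2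
    omega
  have hcA : c ∉ A := fun h' ↦ hc (hAE h')
  obtain ⟨N, B', hN, hMN, hNE, hdN, hNA, hNB, hBB'⟩ := ih (A.ncard - M₂.rankOf A) (by omega) hM₂mem
    (B := insert c B) (by rw [Set.union_insert, hE, hM₂.ground_eq, hM₁.ground_eq])
    (Set.disjoint_insert_right.2 ⟨hcA, hd⟩) (hM₂.indep (hM₁.indep_insert hB) haB) rfl
  refine ⟨N, B', hN, IsMinor.trans ⟨{c}, ∅, ?_⟩ hMN, hNE, hdN, hNA, hNB,
    (Set.subset_insert _ _).trans hBB'⟩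
  rw [delete_empty, hM₂.contract_eq, hM₁.contract_eq]

/-- Points free in the whole matroid are added to `A` until it is a basis; the rank does not change.
-/
lemma IsNatural.exists_extend_basis (h : 𝓜.IsNatural) (hM : 𝓜.Mem M) (hE : A ∪ B = M.E)
    (hd : Disjoint A B) (hA : M.Indep A) (hB : M.Indep B) :
    ∃ (N : Matroid β) (A' : Set β), 𝓜.Mem N ∧ M ≤m N ∧ A' ∪ B = N.E ∧ Disjoint A' B ∧
      N.Indep A' ∧ N.Indep B ∧ N.rankOf N.E = M.rankOf M.E ∧ A'.ncard = M.rankOf M.E := by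
  induction hn : M.rankOf M.E - A.ncard using Nat.strong_induction_on generalizing M A with
  | _ n ih =>
  have hMfin := 𝓜.finite_of_mem _ hM
  have hle : A.ncard ≤ M.rankOf M.E := hA.rankOf_eq_ncard ▸ M.rankOf_mono hA.subset_ground
  by_cases heq : A.ncard = M.rankOf M.E
  · exact ⟨M, A, hM, IsMinor.refl, hE, hd, hA, hB, rfl, heq⟩
  obtain ⟨p, hp⟩ := M.ground_finite.exists_notMem
  have hP := M.isFreeExt_freeExt subset_rfl hp
  set P := M.freeExt M.E p
  have hPfin := hP.finite
  have hpA : p ∉ A := fun h' ↦ hp (hA.subset_ground h')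
  have hpB : p ∉ B := fun h' ↦ hp (hB.subset_ground h')
  have hPE : P.rankOf P.E = M.rankOf M.E := by
    have h1 := hP.rankOf_insert M.E subset_rfl
    rw [boolNat_true (M.subset_closure M.E)] at h1
    rw [hP.ground_eq]
    omega
  have hPA : P.Indep (insert p A) := by
    refine ((hP.indep hA).insert_indep_iff_of_notMem hpA).2 ⟨hP.mem_ground, fun h' ↦ heq ?_⟩
    rw [hP.mem_closure_iff hA.subset_ground] at h'
    have := M.rankOf_mono h'
    rw [rankOf_closure, hA.rankOf_eq_ncard] at this
    omega
  have hcard := Set.ncard_insert_of_notMem hpA (M.ground_finite.subset hA.subset_ground)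
  obtain ⟨N, A', hN, hMN, hNE, hdN, hNA, hNB, hNr, hA'⟩ := ih (P.rankOf P.E - (insert p A).ncard)
    (by omega) (h.freeExt hM hP) (by rw [Set.insert_union, hE, hP.ground_eq])
    (Set.disjoint_insert_left.2 ⟨hpB, hd⟩) hPA (hP.indep hB) rfl
  exact ⟨N, A', hN, IsMinor.trans ⟨∅, {p}, by rw [contract_empty, hP.delete_eq]⟩ hMN, hNE, hdN,
    hNA, hNB, hNr.trans hPE, hA'.trans hPE⟩

/-- Every member of a natural class is a minor of a member whose ground set is the disjoint union
of two independent hyperplanes. -/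
lemma IsNatural.exists_isHyperplanePair (h : 𝓜.IsNatural) (hN : 𝓜.Mem N) :
    ∃ (M : Matroid β) (A B : Set β), 𝓜.Mem M ∧ N ≤m M ∧ M.IsHyperplanePair A B ∧
      M.closure A = A ∧ M.closure B = B ∧ 2 ≤ A.ncard := by
  have := 𝓜.finite_of_mem _ hN
  -- This coloop starts the second part and makes the rank positive, which gives `2 ≤ A.ncard` in
  -- the end.
  obtain ⟨c, hc⟩ := N.ground_finite.exists_notMem
  obtain ⟨N₁, hN₁⟩ := exists_isAddColoop hc
  have := hN₁.finite
  have hcind : N₁.Indep {c} := by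
    rw [← insert_empty_eq]
    exact hN₁.indep_insert N.empty_indep
  obtain ⟨M₁, B₁, hM₁, hNM₁, hE₁, hd₁, hA₁, hB₁, hcB⟩ := h.exists_indep_partition
    (h.addColoop hN hN₁) (A := N.E) (B := {c}) (by rw [hN₁.ground_eq, Set.union_singleton])
    (Set.disjoint_singleton_right.2 hc) hcind
  have := 𝓜.finite_of_mem _ hM₁
  have hpos : 1 ≤ M₁.rankOf M₁.E := by
    have h1 := M₁.rankOf_mono hB₁.subset_ground
    rw [hB₁.rankOf_eq_ncard] at h1
    have h2 := Set.ncard_le_ncard hcB (M₁.ground_finite.subset hB₁.subset_ground)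
    rw [Set.ncard_singleton] at h2
    omega
  obtain ⟨M₂, A, hM₂, hM₁₂, hE₂, hd₂, hA₂, hB₂, hr₂, hAr⟩ :=
    h.exists_extend_basis hM₁ hE₁ hd₁ hA₁ hB₁
  obtain ⟨M₃, B, hM₃, hM₂₃, hE₃, hd₃, hB₃, hA₃, hr₃, hBr⟩ :=
    h.exists_extend_basis hM₂ (by rw [Set.union_comm, hE₂]) hd₂.symm hB₂ hA₂
  have := 𝓜.finite_of_mem _ hM₃
  have hAE := hA₃.subset_ground
  have hBE := hB₃.subset_ground
  -- Both parts are bases now. Two coloops, one for each part, raise the rank by two and each part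
  -- by one, which turns the bases into hyperplanes.
  obtain ⟨z₁, hz₁⟩ := M₃.ground_finite.exists_notMem
  obtain ⟨M₄, hM₄⟩ := exists_isAddColoop hz₁
  have := hM₄.finite
  obtain ⟨z₂, hz₂⟩ := M₄.ground_finite.exists_notMem
  obtain ⟨M₅, hM₅⟩ := exists_isAddColoop hz₂
  have := hM₅.finite
  have hz₂' : z₂ ∉ M₃.E := fun h' ↦ hz₂ (hM₄.subset_ground h')
  have hzz : z₁ ≠ z₂ := fun h' ↦ hz₂ (h' ▸ hM₄.mem_ground)
  have hz₁A : insert z₁ A ⊆ M₄.E := hM₄.ground_eq ▸ Set.insert_subset_insert hAE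
  have hcA := Set.ncard_insert_of_notMem (fun h' ↦ hz₁ (hAE h'))
    (M₃.ground_finite.subset hAE)
  have hcB := Set.ncard_insert_of_notMem (fun h' ↦ hz₂' (hBE h'))
    (M₃.ground_finite.subset hBE)
  have hr₅ : M₅.rankOf M₅.E = M₃.rankOf M₃.E + 2 := by
    rw [hM₅.ground_eq, hM₅.rankOf_insert _ subset_rfl, hM₄.ground_eq,
      hM₄.rankOf_insert _ subset_rfl]
  have hpair : M₅.IsHyperplanePair (insert z₁ A) (insert z₂ B) := by
    refine ⟨?_, ?_, hM₅.indep (hM₄.indep_insert hA₃), hM₅.indep_insert (hM₄.indep hB₃), by omega,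
      by omega⟩
    · rw [Set.insert_union, Set.union_insert, Set.union_comm, hE₃, hM₅.ground_eq, hM₄.ground_eq,
        Set.insert_comm]
    · rw [Set.disjoint_insert_left, Set.disjoint_insert_right, Set.mem_insert_iff, not_or]
      exact ⟨⟨hzz, fun h' ↦ hz₁ (hBE h')⟩, fun h' ↦ hz₂' (hAE h'), hd₃.symm⟩
  have hz₁B : z₁ ∉ M₅.closure (insert z₂ B) := by
    have hBE₄ := hBE.trans hM₄.subset_ground
    rw [mem_closure_iff_rankOf _ (hM₅.subset_ground hM₄.mem_ground), Set.insert_comm,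
      hM₅.rankOf_insert _ (Set.insert_subset hM₄.mem_ground hBE₄), hM₄.rankOf_insert _ hBE,
      hM₅.rankOf_insert _ hBE₄, hM₄.rankOf_eq _ hBE]
    omega
  obtain ⟨M, hM, hMAB, hA, hB, hMc⟩ := h.exists_flats
    (h.addColoop (h.addColoop hM₃ hM₄) hM₅) hpair (Set.mem_insert _ _) (Set.mem_insert _ _) hz₁B
    (hM₅.notMem_closure hz₁A)
  refine ⟨M, _, _, hM, ?_, hMAB, hA, hB, by omega⟩
  have hNN₁ : N ≤m N₁ := ⟨{c}, ∅, by rw [delete_empty, hN₁.contract_eq]⟩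
  refine hNN₁.trans (hNM₁.trans (hM₁₂.trans (hM₂₃.trans ⟨{z₁, z₂}, ∅, ?_⟩)))
  rw [hMc, delete_empty, Set.pair_comm, ← Set.singleton_union, ← contract_contract,
    hM₅.contract_eq, hM₄.contract_eq]

lemma IsNatural.exists_isGadget (h : 𝓜.IsNatural) (hN : 𝓜.Mem N) :
    ∃ (G : Matroid β) (g g' : β) (A B : Set β), 𝓜.Mem G ∧ G.IsGadget g g' A B ∧
      N ≤m G ↾ (A ∪ B) := by
  obtain ⟨M, A, B, hM, hNM, hAB, hA, hB, hA2⟩ := h.exists_isHyperplanePair hN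
  have := 𝓜.finite_of_mem _ hM
  obtain ⟨g, hg⟩ := M.ground_finite.exists_notMem
  have hP := M.isFreeExt_freeExt hAB.indep.subset_ground hg
  set P := M.freeExt A g
  have := hP.finite
  obtain ⟨g', hg'⟩ := P.ground_finite.exists_notMem
  have hG := P.isFreeExt_freeExt (hAB.indep'.subset_ground.trans hP.subset_ground') hg'
  have := hG.finite
  refine ⟨_, g, g', A, B, h.freeExt (h.freeExt hM hP) hG, hAB.isGadget hA hB hA2 hP hG, ?_⟩
  have hMG : M.E ⊆ (P.freeExt B g').E := hP.subset_ground'.trans hG.subset_ground'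
  rw [hAB.union_eq]
  have := restrict_finite (M := P.freeExt B g') M.ground_finite
  rwa [ext_rankOf (M := P.freeExt B g' ↾ M.E) (N := M) rfl fun X hX ↦ ?_]
  rw [restrict_ground_eq] at hX
  rw [rankOf_restrict _ hX, hG.rankOf_eq X (hX.trans hP.subset_ground'), hP.rankOf_eq X hX]

end MatroidClass

open Matroid MatroidClass in
theorem theorem5p2 (𝓜₁ 𝓜₂ : MatroidClass.{u})
    (h₁ : 𝓜₁.IsNatural) (h₂ : 𝓜₂.IsNatural) (hlt : 𝓜₁.ProperSubclass 𝓜₂)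
    (hpin : 𝓜₁.ClosedUnderPinnedExtensions)
    {α : Type u} (N : Matroid α) (hN : 𝓜₁.Mem N) :
    ∃ (β : Type u) (M N' : Matroid β),
      𝓜₁.IsExcludedMinor M ∧ 𝓜₂.Mem M ∧ N'.IsMinor M ∧ N.Isomorphic N' := by
  have := 𝓜₁.finite_of_mem N hN
  -- An infinite ambient type guarantees that new elements are always available.
  obtain ⟨φ, hφ, -⟩ := exists_map_disjoint (β := ULift.{u} ℕ) N Set.finite_empty
  have hN' := h₁.map hN φ hφ
  obtain ⟨G, g, g', A, B, hG, hgad, hNG⟩ := h₁.exists_isGadget hN'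
  have := 𝓜₁.finite_of_mem G hG
  obtain ⟨R, e, e', p, Y, Y', hR, hR₂, hd⟩ :=
    exists_isObstruction h₁ h₂ hlt hN' G.ground_finite
  have := 𝓜₂.finite_of_mem R hR₂
  obtain ⟨L, hL, hL₂, hGL⟩ :=
    hR.exists_isExcludedMinor h₁ h₂ hpin hgad hd hR₂ hG (hlt.1 _ _ hG)
  exact ⟨_, L, _, hL, hL₂, hNG.trans hGL, N.isomorphic_map φ hφ⟩
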